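/- Let $1/2<a\le b<1$, let $R:[a,b]^2\to(0,\infty)$ be continuous, and let $h:[0,\infty)\to[a,b]$ be Hölder continuous. Put $\mathcal R(t,s;H_1,H_2)=R(H_1,H_2)$ if $t\ge s$ and $\mathcal R(t,s;H_1,H_2)=R(H_2,H_1)$ if $t<s$. Let $\tilde S_h=\{\tilde S_h(t)\}_{t\ge0}$ be a centered Gaussian process with covariance $$\mathbb E[\tilde S_h(t)\tilde S_h(s)]=\int_0^t d\theta\int_0^s d\sigma\,\mathcal R(\theta,\sigma;h(\theta),h(\sigma))\,|\theta-\sigma|^{h(\theta)+h(\sigma)-2},\qquad t,s\ge 0.$$ Then there is a centered Gaussian field $\mathcal T=\{\mathcal T(t,u)\}_{t,u\ge0}$, with continuous paths $u\mapsto\mathcal T(t,u)$ and with covariance $$\mathbb E[\mathcal T(t,u)\mathcal T(s,v)]=\begin{cases}\dfrac{R(h(t),h(t))}{4h(t)^2-2h(t)}\left(u^{2h(t)}+v^{2h(t)}-|u-v|^{2h(t)}\right)&\text{if }t=s,\\[1ex]0&\text{if }t\ne s,\end{cases}$$ such that the processes $\mathcal T(t,\cdot)$, $t\ge 0$, are independent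 and the following hold. (1) As $\varepsilon\to0^+$, the finite-dimensional distributions of the field $\left\{\left(\tilde S_h(t+\varepsilon u)-\tilde S_h(t)\right)/\varepsilon^{h(t)}\right\}_{t,u\ge0}$ converge to those of $\mathcal T$. (2) The process $\tilde S_h$ has a continuous modification. For every such modification, still denoted by $\tilde S_h$, and every $t\ge0$, as $\varepsilon\to0^+$ the process $\left\{\left(\tilde S_h(t+\varepsilon u)-\tilde S_h(t)\right)/\varepsilon^{h(t)}\right\}_{u\ge0}$ converges in law to $\mathcal T(t,\cdot)$ in the space $C([0,\infty),\mathbb R)$ with the topology of uniform convergence on compact sets. (3) For every $t\ge0$, $\mathcal T(t,\cdot)$ is a fractional Brownian motion with Hurst index $h(t)$ and $\mathbb E[\mathcal T(t,1)^2]=R(h(t),h(t))/(2h(t)^2-h(t))$. -/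

import Mathlib

open MeasureTheory ProbabilityTheory Filter Set
open scoped NNReal Topology

namespace Multifractional

/-- The space of continuous functions on `[0, ∞)`, whose topology in Mathlib is that of uniform
convergence on compact sets (the compact-open topology), carries its Borel σ-algebra. -/
instance instMeasurableSpacePaths : MeasurableSpace C(ℝ≥0, ℝ) := borel _

instance instBorelSpacePaths : BorelSpace C(ℝ≥0, ℝ) := ⟨rfl⟩

section Kernel

/-- `𝓡(t, s; H₁, H₂)`, which is `R(H₁, H₂)` if `t ≥ s` and `R(H₂, H₁)` if `t < s`. -/
noncomputable def orderedR (R : ℝ → ℝ → ℝ) (t s H₁ H₂ : ℝ) : ℝ :=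
  if s ≤ t then R H₁ H₂ else R H₂ H₁

/-- `𝓡*(θ, σ) = 𝓡(θ, σ; h(θ), h(σ)) |θ - σ| ^ (h(θ) + h(σ) - 2)`. -/
noncomputable def kernel (R : ℝ → ℝ → ℝ) (h : ℝ → ℝ) (θ σ : ℝ) : ℝ :=
  orderedR R θ σ (h θ) (h σ) * |θ - σ| ^ (h θ + h σ - 2)

/-- The covariance `∫₀ᵗ dθ ∫₀ˢ dσ 𝓡*(θ, σ)` of the limit process. -/
noncomputable def limitCov (R : ℝ → ℝ → ℝ) (h : ℝ → ℝ) (t s : ℝ≥0) : ℝ :=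
  ∫ θ in (0 : ℝ)..t, ∫ σ in (0 : ℝ)..s, kernel R h θ σ

/-- The covariance of the tangent field at the points `(t, u)` and `(s, v)`. -/
noncomputable def tangentCov (R : ℝ → ℝ → ℝ) (h : ℝ → ℝ) (p q : ℝ≥0 × ℝ≥0) : ℝ :=
  if p.1 = q.1 then
    R (h p.1) (h p.1) / (4 * h p.1 ^ 2 - 2 * h p.1) *
      ((p.2 : ℝ) ^ (2 * h p.1) + (q.2 : ℝ) ^ (2 * h p.1) - |(p.2 : ℝ) - q.2| ^ (2 * h p.1))
  else 0

end Kernel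

section Processes

/-- `X` is a centered Gaussian process (or field) with covariance function `K`. -/
structure IsCenteredGaussianWithCov {Ω ι : Type*} [MeasurableSpace Ω] (X : ι → Ω → ℝ)
    (K : ι → ι → ℝ) (P : Measure Ω) : Prop where
  gaussian : IsGaussianProcess X P
  centered : ∀ i, ∫ ω, X i ω ∂P = 0
  cov : ∀ i j, ∫ ω, X i ω * X j ω ∂P = K i j

/-- `S` is a version of the limit process: a centered Gaussian process indexed by `[0, ∞)` with
covariance `∫₀ᵗ dθ ∫₀ˢ dσ 𝓡*(θ, σ)`. -/
def IsLimitProcess {Ω : Type*} [MeasurableSpace Ω] (R : ℝ → ℝ → ℝ) (h : ℝ → ℝ)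
    (S : ℝ≥0 → Ω → ℝ) (P : Measure Ω) : Prop :=
  IsCenteredGaussianWithCov S (limitCov R h) P

/-- `W` is a fractional Brownian motion on `[0, ∞)` with Hurst index `H ∈ (0, 1)`: a centered
Gaussian process with covariance `E[W(1)²] / 2 * (t ^ 2H + s ^ 2H - |t - s| ^ 2H)`. -/
structure IsFractionalBrownianMotion {Ω : Type*} [MeasurableSpace Ω] (H : ℝ)
    (W : ℝ≥0 → Ω → ℝ) (P : Measure Ω) : Prop where
  hurst_mem : H ∈ Ioo (0 : ℝ) 1
  centered_gaussian : IsCenteredGaussianWithCov W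
    (fun t s : ℝ≥0 => (∫ ω, W 1 ω ^ 2 ∂P) / 2 *
      ((t : ℝ) ^ (2 * H) + (s : ℝ) ^ (2 * H) - |(t : ℝ) - s| ^ (2 * H))) P

/-- `Y` is a continuous modification of the process `S`. -/
def IsContinuousModification {Ω : Type*} [MeasurableSpace Ω] (Y : Ω → C(ℝ≥0, ℝ))
    (S : ℝ≥0 → Ω → ℝ) (P : Measure Ω) : Prop :=
  ∀ t, (fun ω => Y ω t) =ᵐ[P] S t

end Processes

section Increments

/-- The rescaled increment `(f(t + εu) - f(t)) / ε ^ H`. -/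
noncomputable def rescaledIncrement (f : ℝ≥0 → ℝ) (H : ℝ) (t ε u : ℝ≥0) : ℝ :=
  (f (t + ε * u) - f t) / (ε : ℝ) ^ H

/-- The rescaled increment of a continuous path, as a continuous function of `u`. -/
noncomputable def rescaledPath (f : C(ℝ≥0, ℝ)) (H : ℝ) (t ε : ℝ≥0) : C(ℝ≥0, ℝ) where
  toFun u := rescaledIncrement f H t ε u
  continuous_toFun := by
    unfold rescaledIncrement
    exact ((f.continuous.comp (by fun_prop)).sub continuous_const).div_const _

end Increments

end Multifractional

/-! The substitution `θ = t + εx`, `σ = s + εy` turns the covariance of the rescaled increments into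
the integral of `ε ^ (2 - h t - h s) * kernel R h (t + εx) (s + εy)` over a fixed rectangle. For `t
= s` the integrand is a value of `R`, times `ε ^ (h (t + εx) - h t) * ε ^ (h (t + εy) - h t)`, times
a power of `|x - y|`. Hölder continuity beats the logarithm in `log ε * (h (t + εx) - h t)`, so both
powers of `ε` tend to `1`. The majorant `C * (1 + |x - y| ^ (2a - 2))` is integrable because `a >
1/2`, and dominated convergence leaves `R (h t) (h t) ∫∫ |x - y| ^ (2 h t - 2)`, a fractional
Brownian covariance. For `t ≠ s` the kernel stays bounded while the exponent of `ε` is positive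
because `b < 1`, so the limit is `0` (`IsRegular.tendsto_rescaledCov`).

For centered Gaussian processes, convergence of covariances is convergence of characteristic
functions, which gives (1) by Lévy's theorem. For (2), the same majorant bounds the variance of a
rescaled increment by `C * (v - u) ^ (2a)`, uniformly in `ε ≤ 1`
(`IsRegular.exists_covIncrement_le`). Since `2a > 1`, Chebyshev's inequality and a union bound over
dyadic intervals give both a continuous modification and, through Arzelà-Ascoli, tightness of the
rescaled paths. Prokhorov's theorem then provides limit laws on path space
(`exists_tendsto_of_tight`).

No fractional Brownian motion is constructed beforehand: the limit law at `t` is one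
(`IsRegular.exists_tangentLaw`). The product of these laws over all `t` carries the tangent field,
with independent sections and hence zero covariance for `t ≠ s`. -/

namespace Multifractional

/-! ### Dyadic chaining and compact sets of paths -/

section Chaining

/-- The increments of `g` over the dyadic intervals of length `2⁻ᵐ` in `[0, N]` are bounded
by `M N * ρ ^ m`. -/
def DyadicBound (ρ : ℝ) (M : ℕ → ℝ) (g : ℝ≥0 → ℝ) : Prop :=
  ∀ N m k : ℕ, k + 1 ≤ N * 2 ^ m →
    |g ((k + 1 : ℕ) / 2 ^ m) - g ((k : ℕ) / 2 ^ m)| ≤ M N * ρ ^ m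

/-- The function `g` has modulus of continuity `w N` on `[0, N]`, at the dyadic scales. -/
def HasModulus (w : ℕ → ℕ → ℝ) (g : ℝ≥0 → ℝ) : Prop :=
  ∀ (N n : ℕ) (s t : ℝ≥0), s ≤ N → t ≤ N → dist s t ≤ (1 / 2) ^ n → |g s - g t| ≤ w N n

/-- The largest dyadic number of level `m` which is at most `t`. -/
noncomputable def dyadicFloor (m : ℕ) (t : ℝ≥0) : ℝ≥0 := ⌊2 ^ m * t⌋₊ / 2 ^ m

lemma dyadicFloor_le (m : ℕ) (t : ℝ≥0) : dyadicFloor m t ≤ t := by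
  unfold dyadicFloor
  rw [div_le_iff₀ (by positivity), mul_comm t]
  exact Nat.floor_le (by positivity)

lemma lt_dyadicFloor_add (m : ℕ) (t : ℝ≥0) : t < dyadicFloor m t + (1 / 2) ^ m := by
  have h := Nat.lt_floor_add_one (2 ^ m * t)
  unfold dyadicFloor
  rw [one_div, inv_pow, ← one_div, ← add_div, lt_div_iff₀ (by positivity), mul_comm t]
  exact h

lemma tendsto_dyadicFloor (t : ℝ≥0) :
    Tendsto (fun m => dyadicFloor m t) atTop (𝓝 t) := by
  have h0 : Tendsto (fun m : ℕ => t - (1 / 2) ^ m) atTop (𝓝 (t - 0)) :=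
    tendsto_const_nhds.sub (tendsto_pow_atTop_nhds_zero_of_lt_one (by norm_num) (by
      rw [← NNReal.coe_lt_coe]; norm_num))
  rw [tsub_zero] at h0
  refine tendsto_of_tendsto_of_tendsto_of_le_of_le h0 tendsto_const_nhds (fun m => ?_)
    (fun m => dyadicFloor_le m t)
  exact tsub_le_iff_right.2 (lt_dyadicFloor_add m t).le

variable {ρ : ℝ} {M : ℕ → ℝ} {g : ℝ≥0 → ℝ}

/-- Refining the level either keeps the dyadic floor or moves it by one interval of the finer level,
since `⌊2x⌋` is `2⌊x⌋` or `2⌊x⌋ + 1`. -/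
lemma DyadicBound.abs_sub_dyadicFloor_succ_le (h : DyadicBound ρ M g) (hρ : 0 ≤ ρ)
    (hM : ∀ N, 0 ≤ M N) {N : ℕ} {t : ℝ≥0} (ht : t ≤ N) (m : ℕ) :
    |g (dyadicFloor m t) - g (dyadicFloor (m + 1) t)| ≤ M N * ρ ^ (m + 1) := by
  set k := ⌊2 ^ m * t⌋₊ with hk
  set l := ⌊2 ^ (m + 1) * t⌋₊ with hl
  have h1 : 2 * k ≤ l := by
    apply Nat.le_floor
    push_cast
    rw [pow_succ', mul_assoc]
    gcongr
    exact Nat.floor_le (by positivity)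
  have h2 : l < 2 * k + 2 := by
    rw [hl, Nat.floor_lt (by positivity)]
    push_cast
    have := Nat.lt_floor_add_one (2 ^ m * t)
    calc 2 ^ (m + 1) * t = 2 * (2 ^ m * t) := by ring
      _ < 2 * (k + 1) := by gcongr
      _ = 2 * k + 2 := by ring
  have e : dyadicFloor m t = ((2 * k : ℕ) : ℝ≥0) / 2 ^ (m + 1) := by
    unfold dyadicFloor
    rw [← hk]; push_cast; rw [pow_succ']
    exact (mul_div_mul_left _ _ (by norm_num)).symm
  have e' : dyadicFloor (m + 1) t = (l : ℝ≥0) / 2 ^ (m + 1) := rfl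
  have h3 : l ≤ N * 2 ^ (m + 1) := by
    have : (l : ℝ≥0) ≤ 2 ^ (m + 1) * t := Nat.floor_le (by positivity)
    have : (l : ℝ≥0) ≤ (N * 2 ^ (m + 1) : ℕ) := by
      push_cast
      rw [mul_comm]
      exact this.trans (by gcongr)
    exact_mod_cast this
  rcases (show l = 2 * k ∨ l = 2 * k + 1 by omega) with h4 | h4
  · rw [e, e', h4, sub_self, abs_zero]
    have := hM N
    positivity
  · rw [e, e', h4, abs_sub_comm]
    exact h N (m + 1) (2 * k) (by omega)

/-- Points at distance at most `2⁻ⁿ` have equal or adjacent dyadic floors of level `n`. -/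
lemma DyadicBound.abs_sub_dyadicFloor_le (h : DyadicBound ρ M g) (hρ : 0 ≤ ρ)
    (hM : ∀ N, 0 ≤ M N) {N : ℕ} {s t : ℝ≥0} (ht : t ≤ N) (hst : s ≤ t) {n : ℕ}
    (hd : t ≤ s + (1 / 2) ^ n) :
    |g (dyadicFloor n s) - g (dyadicFloor n t)| ≤ M N * ρ ^ n := by
  set k := ⌊2 ^ n * s⌋₊ with hk
  set l := ⌊2 ^ n * t⌋₊ with hl
  have h1 : k ≤ l := Nat.floor_mono (by gcongr)
  have h2 : l ≤ k + 1 := by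
    have : ⌊2 ^ n * t⌋₊ ≤ ⌊2 ^ n * s + 1⌋₊ := by
      apply Nat.floor_mono
      calc 2 ^ n * t ≤ 2 ^ n * (s + (1 / 2) ^ n) := by gcongr
        _ = 2 ^ n * s + 1 := by
          rw [mul_add, ← mul_pow]; norm_num
    rwa [Nat.floor_add_one (by positivity)] at this
  have h3 : l ≤ N * 2 ^ n := by
    have : (l : ℝ≥0) ≤ 2 ^ n * t := Nat.floor_le (by positivity)
    have : (l : ℝ≥0) ≤ (N * 2 ^ n : ℕ) := by
      push_cast
      rw [mul_comm]
      exact this.trans (by gcongr)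
    exact_mod_cast this
  have e : dyadicFloor n s = (k : ℝ≥0) / 2 ^ n := rfl
  have e' : dyadicFloor n t = (l : ℝ≥0) / 2 ^ n := rfl
  rcases (show l = k ∨ l = k + 1 by omega) with h4 | h4
  · rw [e, e', h4, sub_self, abs_zero]
    have := hM N
    positivity
  · rw [e, e', h4, abs_sub_comm]
    exact h N n k (by omega)

lemma DyadicBound.cauchySeq (h : DyadicBound ρ M g) (hρ : 0 ≤ ρ) (hρ1 : ρ < 1)
    (hM : ∀ N, 0 ≤ M N) (t : ℝ≥0) : CauchySeq fun m => g (dyadicFloor m t) := by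
  obtain ⟨N, hN⟩ := exists_nat_ge t
  refine cauchySeq_of_le_geometric ρ (M N * ρ) hρ1 fun m => ?_
  rw [Real.dist_eq, mul_assoc, ← pow_succ']
  exact h.abs_sub_dyadicFloor_succ_le hρ hM hN m

/-- A function with a dyadic bound has a modulus of continuity, wherever it is the limit of its
values along dyadic numbers. -/
lemma DyadicBound.abs_sub_le (h : DyadicBound ρ M g) (hρ : 0 ≤ ρ) (hρ1 : ρ < 1)
    (hM : ∀ N, 0 ≤ M N) {N n : ℕ} {s t : ℝ≥0} (hs : s ≤ N) (ht : t ≤ N)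
    (hd : dist s t ≤ (1 / 2) ^ n) {x y : ℝ}
    (hx : Tendsto (fun m => g (dyadicFloor m s)) atTop (𝓝 x))
    (hy : Tendsto (fun m => g (dyadicFloor m t)) atTop (𝓝 y)) :
    |x - y| ≤ M N * (3 / (1 - ρ)) * ρ ^ n := by
  wlog hst : s ≤ t generalizing s t x y
  · rw [abs_sub_comm]
    exact this ht hs (by rwa [dist_comm]) hy hx (not_le.1 hst).le
  have key : ∀ {r : ℝ≥0} {z : ℝ}, r ≤ N →
      Tendsto (fun m => g (dyadicFloor m r)) atTop (𝓝 z) →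
      |g (dyadicFloor n r) - z| ≤ M N * (1 / (1 - ρ)) * ρ ^ n := fun {r z} hr hz => by
    have := dist_le_of_le_geometric_of_tendsto ρ (M N) hρ1 (fun m => ?_) hz n
    · rw [Real.dist_eq] at this
      exact this.trans_eq (by ring)
    · rw [Real.dist_eq]
      refine (h.abs_sub_dyadicFloor_succ_le hρ hM hr m).trans ?_
      have := hM N
      gcongr M N * ?_
      exact pow_le_pow_of_le_one hρ hρ1.le (Nat.le_succ m)
  have hd' : t ≤ s + (1 / 2) ^ n := by
    rw [← NNReal.coe_le_coe]
    push_cast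
    rw [NNReal.dist_eq, abs_sub_comm, abs_of_nonneg (sub_nonneg.2 (by exact_mod_cast hst))] at hd
    linarith
  have h1 := key hs hx
  have h2 := key ht hy
  have h3 := h.abs_sub_dyadicFloor_le hρ hM ht hst hd'
  -- The factor `3 / (1 - ρ)` counts two geometric tails and the middle jump, which is weakened to
  -- the size of a tail.
  have h4 : M N * ρ ^ n ≤ M N * (1 / (1 - ρ)) * ρ ^ n := by
    have := hM N
    rw [mul_assoc]
    gcongr
    refine le_mul_of_one_le_left (by positivity) ?_
    rw [le_div_iff₀ (by linarith)]; linarith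
  calc |x - y| = |-(g (dyadicFloor n s) - x) + (g (dyadicFloor n s) - g (dyadicFloor n t))
        + (g (dyadicFloor n t) - y)| := by congr 1; ring
    _ ≤ |g (dyadicFloor n s) - x| + |g (dyadicFloor n s) - g (dyadicFloor n t)|
        + |g (dyadicFloor n t) - y| := by
      refine (abs_add_le _ _).trans (add_le_add_left ((abs_add_le _ _).trans_eq ?_) _)
      rw [abs_neg]
    _ ≤ M N * (1 / (1 - ρ)) * ρ ^ n + M N * (1 / (1 - ρ)) * ρ ^ n
        + M N * (1 / (1 - ρ)) * ρ ^ n := by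
      gcongr
      exact h3.trans h4
    _ = _ := by ring

variable {w : ℕ → ℕ → ℝ}

/-- Here `δ` is chosen before `g`, so that the same estimate yields continuity and equicontinuity.
-/
lemma HasModulus.exists_dist_lt (hw : ∀ N, Tendsto (w N) atTop (𝓝 0)) (t : ℝ≥0) {ε : ℝ}
    (hε : 0 < ε) : ∃ δ > 0, ∀ g, HasModulus w g → ∀ s, dist s t < δ → dist (g t) (g s) < ε := by
  obtain ⟨N, hN⟩ := exists_nat_ge (t + 1)
  obtain ⟨n, hn⟩ := ((hw N).eventually_lt_const hε).exists
  refine ⟨(1 / 2) ^ n, by positivity, fun g hg s hs => ?_⟩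
  rw [Real.dist_eq]
  refine (hg N n t s (le_self_add.trans hN) ?_ (by rw [dist_comm]; exact hs.le)).trans_lt hn
  have h1 : dist s t ≤ 1 := hs.le.trans (pow_le_one₀ (by norm_num) (by norm_num))
  rw [NNReal.dist_eq] at h1
  refine le_trans ?_ hN
  rw [← NNReal.coe_le_coe]
  push_cast
  linarith [(abs_le.1 h1).2]

lemma HasModulus.continuous (hw : ∀ N, Tendsto (w N) atTop (𝓝 0)) (hg : HasModulus w g) :
    Continuous g := by
  rw [continuous_iff_continuousAt]
  intro t
  rw [Metric.continuousAt_iff]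
  intro ε hε
  obtain ⟨δ, hδ, h⟩ := HasModulus.exists_dist_lt hw t hε
  exact ⟨δ, hδ, fun {s} hs => by rw [dist_comm]; exact h g hg s hs⟩

/-- Walk from `0` to `t` in unit steps: `w N 0` controls increments over distance at most `1`. -/
lemma HasModulus.abs_le (hg : HasModulus w g) (h0 : g 0 = 0) {N : ℕ} (k : ℕ) (hk : k ≤ N)
    {t : ℝ≥0} (ht : t ≤ k) : |g t| ≤ k * w N 0 := by
  induction k generalizing t with
  | zero =>
    have : t = 0 := le_antisymm (by simpa using ht) zero_le
    simp [this, h0]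
  | succ k ih =>
    have h1 := ih (by omega) (t := min t k) (min_le_right _ _)
    have hkN : (k : ℝ≥0) ≤ N := by exact_mod_cast (by omega : k ≤ N)
    have hkN' : ((k + 1 : ℕ) : ℝ≥0) ≤ N := by exact_mod_cast hk
    have h2 := hg N 0 t (min t k) (ht.trans hkN') ((min_le_right _ _).trans hkN) (by
      rw [NNReal.dist_eq, pow_zero]
      have hle : ((min t k : ℝ≥0) : ℝ) ≤ t := by exact_mod_cast min_le_left t (k : ℝ≥0)
      rw [abs_of_nonneg (by linarith)]
      have ht' : (t : ℝ) ≤ k + 1 := by exact_mod_cast ht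
      rcases le_total t (k : ℝ≥0) with h | h
      · rw [min_eq_left h]; simp
      · rw [min_eq_right h]; push_cast; linarith)
    calc |g t| = |(g t - g (min t k)) + g (min t k)| := by congr 1; ring
      _ ≤ |g t - g (min t k)| + |g (min t k)| := abs_add_le _ _
      _ ≤ w N 0 + k * w N 0 := add_le_add h2 h1
      _ = ((k + 1 : ℕ) : ℝ) * w N 0 := by push_cast; ring

lemma isClosed_setOf_hasModulus : IsClosed {g : ℝ≥0 → ℝ | g 0 = 0 ∧ HasModulus w g} := by
  refine (isClosed_eq (continuous_apply 0) continuous_const).inter ?_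
  change IsClosed {g : ℝ≥0 → ℝ | HasModulus w g}
  simp only [HasModulus, ofPred_forall]
  refine isClosed_iInter fun N => isClosed_iInter fun n => isClosed_iInter fun s =>
    isClosed_iInter fun t => isClosed_iInter fun _ => isClosed_iInter fun _ =>
    isClosed_iInter fun _ => ?_
  exact isClosed_le (by fun_prop) continuous_const

/-- A set of paths started at `0` with a common modulus of continuity is compact
(**Arzelà-Ascoli**). -/
lemma isCompact_setOf_hasModulus (hw : ∀ N, Tendsto (w N) atTop (𝓝 0)) :
    IsCompact {f : C(ℝ≥0, ℝ) | f 0 = 0 ∧ HasModulus w f} := by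
  apply ArzelaAscoli.isCompact_of_equicontinuous
  · have himg : ContinuousMap.toFun '' {f : C(ℝ≥0, ℝ) | f 0 = 0 ∧ HasModulus w f} =
        {g : ℝ≥0 → ℝ | g 0 = 0 ∧ HasModulus w g} := by
      ext g
      constructor
      · rintro ⟨f, hf, rfl⟩
        exact hf
      · intro hg
        exact ⟨⟨g, hg.2.continuous hw⟩, hg, rfl⟩
    rw [himg]
    -- By Tychonoff: the set is closed under pointwise limits and lies in a product of compact
    -- intervals.
    refine IsCompact.of_isClosed_subset
      (isCompact_univ_pi fun t : ℝ≥0 => isCompact_Icc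
        (a := -(⌈t⌉₊ * w ⌈t⌉₊ 0)) (b := ⌈t⌉₊ * w ⌈t⌉₊ 0)) isClosed_setOf_hasModulus ?_
    intro g hg t _
    exact abs_le.1 (hg.2.abs_le hg.1 ⌈t⌉₊ le_rfl (Nat.le_ceil t))
  · intro t
    rw [Metric.equicontinuousAt_iff]
    intro ε hε
    obtain ⟨δ, hδ, h⟩ := HasModulus.exists_dist_lt hw t hε
    exact ⟨δ, hδ, fun s hs f => h f.1 f.2.2 s hs⟩

lemma tendsto_mul_pow_zero (hρ : 0 ≤ ρ) (hρ1 : ρ < 1) (c : ℝ) :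
    Tendsto (fun n => c * ρ ^ n) atTop (𝓝 0) := by
  simpa using (tendsto_pow_atTop_nhds_zero_of_lt_one hρ hρ1).const_mul c

lemma DyadicBound.hasModulus (h : DyadicBound ρ M g) (hρ : 0 ≤ ρ) (hρ1 : ρ < 1)
    (hM : ∀ N, 0 ≤ M N) (hg : Continuous g) :
    HasModulus (fun N n => M N * (3 / (1 - ρ)) * ρ ^ n) g := fun _ _ s t hs ht hd =>
  h.abs_sub_le hρ hρ1 hM hs ht hd ((hg.tendsto s).comp (tendsto_dyadicFloor s))
    ((hg.tendsto t).comp (tendsto_dyadicFloor t))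

/-- A function with a dyadic bound coincides along dyadic numbers with a continuous function. -/
lemma DyadicBound.exists_continuousMap (h : DyadicBound ρ M g) (hρ : 0 ≤ ρ) (hρ1 : ρ < 1)
    (hM : ∀ N, 0 ≤ M N) :
    ∃ f : C(ℝ≥0, ℝ), ∀ t, Tendsto (fun m => g (dyadicFloor m t)) atTop (𝓝 (f t)) := by
  choose f hf using fun t => cauchySeq_tendsto_of_complete (h.cauchySeq hρ hρ1 hM t)
  have hmod : HasModulus (fun N n => M N * (3 / (1 - ρ)) * ρ ^ n) f :=
    fun _ _ s t hs ht hd => h.abs_sub_le hρ hρ1 hM hs ht hd (hf s) (hf t)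
  exact ⟨⟨f, hmod.continuous fun N => tendsto_mul_pow_zero hρ hρ1 _⟩, hf⟩

/-- A dyadic bound is a closed condition on paths and implies a modulus of continuity. These are the
compact sets that witness tightness. -/
lemma isCompact_setOf_dyadicBound (hρ : 0 ≤ ρ) (hρ1 : ρ < 1) (hM : ∀ N, 0 ≤ M N) :
    IsCompact {f : C(ℝ≥0, ℝ) | f 0 = 0 ∧ DyadicBound ρ M f} := by
  refine IsCompact.of_isClosed_subset (isCompact_setOf_hasModulus
    (w := fun N n => M N * (3 / (1 - ρ)) * ρ ^ n) fun N => tendsto_mul_pow_zero hρ hρ1 _) ?_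
    fun f hf => ⟨hf.1, hf.2.hasModulus hρ hρ1 hM f.continuous⟩
  refine (isClosed_eq (ContinuousEvalConst.continuous_eval_const 0) continuous_const).inter ?_
  change IsClosed {f : C(ℝ≥0, ℝ) | DyadicBound ρ M f}
  simp only [DyadicBound, ofPred_forall]
  refine isClosed_iInter fun N => isClosed_iInter fun m => isClosed_iInter fun k =>
    isClosed_iInter fun _ => ?_
  exact isClosed_le (by fun_prop) continuous_const

end Chaining

/-! ### Measurability of random paths -/

section PathSpace

/-- A random continuous path is measurable as soon as its coordinates are. -/
lemma aemeasurable_continuousMap {Ω : Type*} [MeasurableSpace Ω] {P : Measure Ω}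
    {Y : Ω → C(ℝ≥0, ℝ)} (hY : ∀ t, AEMeasurable (fun ω => Y ω t) P) : AEMeasurable Y P := by
  let u : ℕ → ℝ≥0 := TopologicalSpace.denseSeq ℝ≥0
  -- A continuous injection between Polish spaces is a measurable embedding; a path is determined by
  -- its values on a dense sequence.
  have hemb : MeasurableEmbedding (fun (f : C(ℝ≥0, ℝ)) (n : ℕ) => f (u n)) := by
    refine Continuous.measurableEmbedding (by fun_prop) fun f g hfg => ?_
    refine DFunLike.coe_injective ((TopologicalSpace.denseRange_denseSeq ℝ≥0).equalizer
      f.continuous g.continuous ?_)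
    ext n
    exact congrFun hfg n
  rw [← hemb.aemeasurable_comp_iff]
  exact aemeasurable_pi_lambda _ fun n => hY (u n)

end PathSpace

/-! ### Integrals of powers of the distance -/

section PowerIntegrals

variable {p : ℝ}

lemma intervalIntegrable_abs_rpow (hp : -1 < p) (c d : ℝ) :
    IntervalIntegrable (fun z : ℝ => |z| ^ p) volume c d := by
  have pos : ∀ e : ℝ, 0 ≤ e → IntervalIntegrable (fun z : ℝ => |z| ^ p) volume 0 e := by
    intro e he
    refine (intervalIntegral.intervalIntegrable_rpow' (a := 0) (b := e) hp).congr fun z hz => ?_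
    rw [uIoc_of_le he] at hz
    simp only [abs_of_pos hz.1]
  have all : ∀ e : ℝ, IntervalIntegrable (fun z : ℝ => |z| ^ p) volume 0 e := by
    intro e
    rcases le_total 0 e with he | he
    · exact pos e he
    · rw [IntervalIntegrable.iff_comp_neg]
      simpa using pos (-e) (by linarith)
  exact (all c).symm.trans (all d)

lemma integral_zero_abs_rpow (hp : -1 < p) (d : ℝ) :
    ∫ z in (0 : ℝ)..d, |z| ^ p = |d| ^ p * d / (p + 1) := by
  have pos : ∀ e : ℝ, 0 ≤ e → ∫ z in (0 : ℝ)..e, |z| ^ p = |e| ^ p * e / (p + 1) := by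
    intro e he
    rw [intervalIntegral.integral_congr (g := fun z => z ^ p) fun z hz => by
      rw [uIcc_of_le he] at hz
      simp only [abs_of_nonneg hz.1], integral_rpow (Or.inl hp),
      Real.zero_rpow (by linarith), sub_zero, abs_of_nonneg he]
    rcases he.eq_or_lt with rfl | he
    · rw [Real.zero_rpow (by linarith), mul_zero]
    · rw [Real.rpow_add_one he.ne']
  rcases le_total 0 d with hd | hd
  · exact pos d hd
  · have h := intervalIntegral.integral_comp_neg (a := 0) (b := -d) fun z : ℝ => |z| ^ p
    simp only [abs_neg, neg_neg, neg_zero] at h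
    rw [intervalIntegral.integral_symm, ← h, pos (-d) (by linarith), abs_neg]
    ring

lemma integral_abs_rpow (hp : -1 < p) (c d : ℝ) :
    ∫ z in c..d, |z| ^ p = |d| ^ p * d / (p + 1) - |c| ^ p * c / (p + 1) := by
  rw [← integral_zero_abs_rpow hp, ← integral_zero_abs_rpow hp,
    intervalIntegral.integral_interval_sub_left (intervalIntegrable_abs_rpow hp _ _)
      (intervalIntegrable_abs_rpow hp _ _)]

lemma intervalIntegrable_abs_sub_rpow (hp : -1 < p) (x c d : ℝ) :
    IntervalIntegrable (fun y : ℝ => |x - y| ^ p) volume c d := by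
  have := (intervalIntegrable_abs_rpow hp (x - c) (x - d)).comp_sub_left x
  simpa using this

lemma hasDerivAt_abs_rpow_antideriv (hp : -1 < p) (x e : ℝ) :
    HasDerivAt (fun x => |x - e| ^ (p + 2) / ((p + 1) * (p + 2)))
      (|x - e| ^ p * (x - e) / (p + 1)) x := by
  have h := ((hasDerivAt_abs_rpow (x - e) (p := p + 2) (by linarith)).comp x
    ((hasDerivAt_id x).sub_const e)).div_const ((p + 1) * (p + 2))
  refine h.congr_deriv ?_
  have h1 : p + 1 ≠ 0 := by linarith
  have h2 : p + 2 ≠ 0 := by linarith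
  rw [add_sub_cancel_right]
  field_simp

/-- For negative `p` the factor `|x| ^ p` is discontinuous at `0`; the product is continuous as a
primitive of an integrable function. -/
lemma continuous_abs_rpow_mul (hp : -1 < p) :
    Continuous fun x : ℝ => |x| ^ p * x / (p + 1) := by
  simp_rw [← integral_zero_abs_rpow hp]
  exact intervalIntegral.continuous_primitive (fun c d => intervalIntegrable_abs_rpow hp c d) 0

/-- The integral of `|x - y| ^ p` over a rectangle. -/
lemma integral_integral_abs_sub_rpow (hp : -1 < p) (c d c' d' : ℝ) :
    ∫ x in c..d, ∫ y in c'..d', |x - y| ^ p =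
      (|d - c'| ^ (p + 2) - |c - c'| ^ (p + 2) - |d - d'| ^ (p + 2) + |c - d'| ^ (p + 2)) /
        ((p + 1) * (p + 2)) := by
  have h1 : ∀ x, ∫ y in c'..d', |x - y| ^ p =
      |x - c'| ^ p * (x - c') / (p + 1) - |x - d'| ^ p * (x - d') / (p + 1) := fun x => by
    rw [intervalIntegral.integral_comp_sub_left (fun z => |z| ^ p), integral_abs_rpow hp]
  simp_rw [h1]
  have hint : ∀ e, IntervalIntegrable (fun x => |x - e| ^ p * (x - e) / (p + 1)) volume c d :=
    fun e => ((continuous_abs_rpow_mul hp).comp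
      (continuous_id.sub continuous_const)).intervalIntegrable _ _
  rw [intervalIntegral.integral_sub (hint _) (hint _),
    intervalIntegral.integral_eq_sub_of_hasDerivAt
      (fun x _ => hasDerivAt_abs_rpow_antideriv hp x c') (hint _),
    intervalIntegral.integral_eq_sub_of_hasDerivAt
      (fun x _ => hasDerivAt_abs_rpow_antideriv hp x d') (hint _)]
  ring

lemma integrableOn_abs_sub_rpow (hp : -1 < p) (c d c' d' : ℝ) :
    IntegrableOn (fun q : ℝ × ℝ => |q.1 - q.2| ^ p) (Ioc c d ×ˢ Ioc c' d') := by
  let N : ℝ := d - c'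
  let m : ℝ := c - d'
  have hf : Integrable ((Ioc c' d').indicator fun _ => (1 : ℝ)) :=
    (integrable_indicator_iff measurableSet_Ioc).2 (by simp)
  have hg : Integrable ((Ioc (m - 1) N).indicator fun z => |z| ^ p) := by
    rw [integrable_indicator_iff measurableSet_Ioc]
    exact (intervalIntegrable_abs_rpow hp _ _).1
  -- On the rectangle the function is a convolution integrand of two integrable functions: the
  -- indicator in `y` and the power cut off to an interval containing all values of `x - y`.
  have h := hf.convolution_integrand (ContinuousLinearMap.mul ℝ ℝ) hg
  refine (h.integrableOn (s := Ioc c d ×ˢ Ioc c' d')).congr_fun ?_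
    (measurableSet_Ioc.prod measurableSet_Ioc)
  rintro ⟨x, y⟩ ⟨hx, hy⟩
  have hxy : x - y ∈ Ioc (m - 1) N :=
    ⟨by simp only [m]; linarith [hx.1, hy.2], by simp only [N]; linarith [hx.2, hy.1]⟩
  simp only [ContinuousLinearMap.mul_apply']
  rw [indicator_of_mem hy, indicator_of_mem hxy, one_mul]

end PowerIntegrals

/-! ### Bounds and scaling limit of the kernel -/

section KernelEstimates

/-- The assumptions on `R` and `h`, for functions which are regular on the whole of `ℝ²` and `ℝ`. -/
structure IsRegular (a b : ℝ) (R : ℝ → ℝ → ℝ) (h : ℝ → ℝ) : Prop where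
  half_lt : 1 / 2 < a
  lt_one : b < 1
  continuous_R : Continuous (Function.uncurry R)
  bounded : ∃ C, 0 ≤ C ∧ ∀ x y, |R x y| ≤ C
  mem : ∀ x, h x ∈ Icc a b
  holder : ∃ D r : ℝ, 0 ≤ D ∧ 0 < r ∧ ∀ x y, |h x - h y| ≤ D * |x - y| ^ r

variable {a b : ℝ} {R : ℝ → ℝ → ℝ} {h : ℝ → ℝ}

lemma IsRegular.continuous_h (H : IsRegular a b R h) : Continuous h := by
  obtain ⟨D, r, -, hr, hD⟩ := H.holder
  rw [continuous_iff_continuousAt]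
  intro x
  rw [ContinuousAt, tendsto_iff_dist_tendsto_zero]
  have h0 : Tendsto (fun y => D * |y - x| ^ r) (𝓝 x) (𝓝 0) := by
    have : Continuous fun y => D * |y - x| ^ r :=
      continuous_const.mul
        (((continuous_id'.sub continuous_const).abs).rpow_const fun _ => Or.inr hr.le)
    simpa [Real.zero_rpow hr.ne'] using this.tendsto x
  exact squeeze_zero (fun _ => dist_nonneg) (fun y => hD y x) h0

/-- For `z ≥ 1` the left side is at most `1`; for `0 < z ≤ 1` powers decrease in the exponent. At `z
= 0` both powers are `0` by convention. This replaces the varying exponent of the kernel by the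
fixed `2a - 2`. -/
lemma rpow_le_one_add_rpow {z p q : ℝ} (hz : 0 ≤ z) (hpq : p ≤ q) (hq : q < 0) :
    z ^ q ≤ 1 + z ^ p := by
  rcases hz.eq_or_lt with rfl | hz
  · rw [Real.zero_rpow hq.ne, Real.zero_rpow (by linarith)]; norm_num
  rcases le_total z 1 with h1 | h1
  · have := Real.rpow_le_rpow_of_exponent_ge hz h1 hpq
    linarith
  · have := Real.rpow_le_one_of_one_le_of_nonpos h1 hq.le
    have := Real.rpow_nonneg hz.le p
    linarith

lemma abs_orderedR_le {C : ℝ} (hC : ∀ x y, |R x y| ≤ C) (t s x y : ℝ) :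
    |orderedR R t s x y| ≤ C := by
  unfold orderedR
  split_ifs
  · exact hC _ _
  · exact hC _ _

lemma IsRegular.abs_kernel_le (H : IsRegular a b R h) {C : ℝ} (hC0 : 0 ≤ C)
    (hC : ∀ x y, |R x y| ≤ C) (θ σ : ℝ) :
    |kernel R h θ σ| ≤ C * (1 + |θ - σ| ^ (2 * a - 2)) := by
  unfold kernel
  rw [abs_mul, abs_of_nonneg (Real.rpow_nonneg (abs_nonneg _) _)]
  have h1 := H.mem θ
  have h2 := H.mem σ
  have h3 := H.lt_one
  gcongr
  · exact abs_orderedR_le hC _ _ _ _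
  · exact rpow_le_one_add_rpow (abs_nonneg _) (by linarith [h1.1, h2.1]) (by linarith [h1.2, h2.2])

lemma IsRegular.measurable_kernel (H : IsRegular a b R h) :
    Measurable fun q : ℝ × ℝ => kernel R h q.1 q.2 := by
  have hR := H.continuous_R
  have hh := H.continuous_h
  have hR' : ∀ f g : ℝ × ℝ → ℝ, Continuous f → Continuous g →
      Measurable fun q => R (f q) (g q) := fun f g hf hg =>
    (hR.comp (hf.prodMk hg)).measurable
  unfold kernel orderedR
  refine Measurable.mul (Measurable.ite (measurableSet_le (by fun_prop) (by fun_prop)) ?_ ?_) ?_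
  · exact hR' _ _ (by fun_prop) (by fun_prop)
  · exact hR' _ _ (by fun_prop) (by fun_prop)
  · exact Measurable.pow (by fun_prop) (by fun_prop)

lemma IsRegular.neg_one_lt (H : IsRegular a b R h) : -1 < 2 * a - 2 := by
  linarith [H.half_lt]

lemma integrableOn_const_mul_one_add_rpow {p : ℝ} (hp : -1 < p) (C c d c' d' : ℝ) :
    IntegrableOn (fun q : ℝ × ℝ => C * (1 + |q.1 - q.2| ^ p)) (Ioc c d ×ˢ Ioc c' d') := by
  refine ((Integrable.add ?_ (integrableOn_abs_sub_rpow hp c d c' d'))).const_mul C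
  refine integrableOn_const ?_
  rw [Measure.volume_eq_prod, Measure.prod_prod]
  exact (ENNReal.mul_lt_top (by simp) (by simp)).ne

lemma IsRegular.integrableOn_kernel (H : IsRegular a b R h) (c d c' d' : ℝ) :
    IntegrableOn (fun q : ℝ × ℝ => kernel R h q.1 q.2) (Ioc c d ×ˢ Ioc c' d') := by
  obtain ⟨C, hC0, hC⟩ := H.bounded
  refine (integrableOn_const_mul_one_add_rpow H.neg_one_lt C c d c' d').mono'
    H.measurable_kernel.aestronglyMeasurable ?_
  exact Eventually.of_forall fun q => H.abs_kernel_le hC0 hC q.1 q.2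

lemma IsRegular.intervalIntegrable_kernel (H : IsRegular a b R h) (θ c d : ℝ) :
    IntervalIntegrable (kernel R h θ) volume c d := by
  obtain ⟨C, hC0, hC⟩ := H.bounded
  refine IntervalIntegrable.mono_fun'
    ((intervalIntegrable_const (c := (1 : ℝ))).add
      (intervalIntegrable_abs_sub_rpow H.neg_one_lt θ c d) |>.const_mul C) ?_ ?_
  · exact (H.measurable_kernel.comp measurable_prodMk_left).aestronglyMeasurable
  · exact Eventually.of_forall fun σ => H.abs_kernel_le hC0 hC θ σ

lemma IsRegular.intervalIntegrable_integral_kernel (H : IsRegular a b R h) (c d e f : ℝ) :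
    IntervalIntegrable (fun θ => ∫ σ in e..f, kernel R h θ σ) volume c d := by
  wlog hef : e ≤ f generalizing e f
  · simp_rw [intervalIntegral.integral_symm f e]
    exact (this f e (not_le.1 hef).le).neg
  have key : ∀ c d : ℝ, IntegrableOn (fun θ => ∫ σ in e..f, kernel R h θ σ) (Ioc c d) := by
    intro c d
    have h1 := H.integrableOn_kernel c d e f
    rw [IntegrableOn, Measure.volume_eq_prod, ← Measure.prod_restrict] at h1
    simpa only [intervalIntegral.integral_of_le hef] using! h1.integral_prod_left
  exact ⟨key c d, key d c⟩

/-- The mixed second differences of the covariance. -/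
lemma IsRegular.limitCov_increments (H : IsRegular a b R h) (t t' s s' : ℝ≥0) :
    limitCov R h t' s' - limitCov R h t' s - limitCov R h t s' + limitCov R h t s =
      ∫ θ in (t : ℝ)..t', ∫ σ in (s : ℝ)..s', kernel R h θ σ := by
  have h1 : ∀ τ : ℝ≥0, limitCov R h τ s' - limitCov R h τ s =
      ∫ θ in (0 : ℝ)..τ, ∫ σ in (s : ℝ)..s', kernel R h θ σ := fun τ => by
    unfold limitCov
    rw [← intervalIntegral.integral_sub (H.intervalIntegrable_integral_kernel _ _ _ _)
      (H.intervalIntegrable_integral_kernel _ _ _ _)]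
    refine intervalIntegral.integral_congr fun θ _ => ?_
    exact intervalIntegral.integral_interval_sub_left (H.intervalIntegrable_kernel _ _ _)
      (H.intervalIntegrable_kernel _ _ _)
  rw [← intervalIntegral.integral_interval_sub_left
    (H.intervalIntegrable_integral_kernel 0 t' s s')
    (H.intervalIntegrable_integral_kernel 0 t s s'), ← h1, ← h1]
  ring

lemma integral_integral_comp_add_mul (k : ℝ → ℝ → ℝ) (t s ε c d c' d' : ℝ) :
    ∫ θ in t + ε * c..t + ε * d, ∫ σ in s + ε * c'..s + ε * d', k θ σ =
      ε ^ 2 * ∫ x in c..d, ∫ y in c'..d', k (t + ε * x) (s + ε * y) := by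
  rw [← intervalIntegral.smul_integral_comp_add_mul]
  simp_rw [← intervalIntegral.smul_integral_comp_add_mul, smul_eq_mul]
  rw [intervalIntegral.integral_const_mul]
  ring

/-- This is `log x ≤ x ^ r / r` at `x = ε⁻¹`. -/
lemma abs_log_mul_rpow_le {r ε : ℝ} (hr : 0 < r) (hε : 0 < ε) (hε1 : ε ≤ 1) :
    |Real.log ε| * ε ^ r ≤ 1 / r := by
  rw [abs_of_nonpos (Real.log_nonpos hε.le hε1), ← Real.log_inv]
  have h1 := Real.log_le_rpow_div (x := ε⁻¹) (by positivity) hr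
  rw [Real.inv_rpow hε.le] at h1
  calc Real.log ε⁻¹ * ε ^ r ≤ (ε ^ r)⁻¹ / r * ε ^ r := by gcongr
    _ = 1 / r := by
      have : ε ^ r ≠ 0 := (Real.rpow_pos_of_pos hε r).ne'
      field_simp

lemma abs_log_mul_holder_le {D r : ℝ} (hD : ∀ x y, |h x - h y| ≤ D * |x - y| ^ r)
    (t x : ℝ) {ε : ℝ} (hε : 0 < ε) :
    |Real.log ε * (h (t + ε * x) - h t)| ≤ D * |x| ^ r * (|Real.log ε| * ε ^ r) := by
  rw [abs_mul]
  have h1 := hD (t + ε * x) t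
  rw [add_sub_cancel_left, abs_mul, abs_of_pos hε, Real.mul_rpow hε.le (abs_nonneg _)] at h1
  calc |Real.log ε| * |h (t + ε * x) - h t| ≤ |Real.log ε| * (D * (ε ^ r * |x| ^ r)) := by gcongr
    _ = _ := by ring

lemma IsRegular.exists_rpow_le (H : IsRegular a b R h) (N : ℝ) :
    ∃ B, 0 ≤ B ∧ ∀ t ε x, 0 < ε → ε ≤ 1 → 0 ≤ x → x ≤ N → ε ^ (h (t + ε * x) - h t) ≤ B := by
  obtain ⟨D, r, hD0, hr, hD⟩ := H.holder
  refine ⟨Real.exp (D * |N| ^ r * (1 / r)), (Real.exp_pos _).le, fun t ε x hε hε1 hx hxN => ?_⟩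
  rw [Real.rpow_def_of_pos hε, Real.exp_le_exp]
  refine (le_abs_self _).trans ((abs_log_mul_holder_le hD t x hε).trans ?_)
  have := abs_log_mul_rpow_le hr hε hε1
  have : |x| ≤ |N| := by rw [abs_of_nonneg hx, abs_of_nonneg (hx.trans hxN)]; exact hxN
  gcongr

/-- The exponent difference is `O(ε ^ r)` and `ε ^ r * log ε → 0`. Mere continuity of `h` would not
be enough for this argument. -/
lemma IsRegular.tendsto_rpow (H : IsRegular a b R h) (t x : ℝ) :
    Tendsto (fun ε : ℝ => ε ^ (h (t + ε * x) - h t)) (𝓝[>] 0) (𝓝 1) := by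
  obtain ⟨D, r, hD0, hr, hD⟩ := H.holder
  have h1 : Tendsto (fun ε : ℝ => Real.log ε * (h (t + ε * x) - h t)) (𝓝[>] 0) (𝓝 0) := by
    have h2 : Tendsto (fun ε : ℝ => D * |x| ^ r * (|Real.log ε| * ε ^ r)) (𝓝[>] 0) (𝓝 0) := by
      have h3 := (tendsto_log_mul_rpow_nhdsGT_zero hr).abs.const_mul (D * |x| ^ r)
      rw [abs_zero, mul_zero] at h3
      refine h3.congr' ?_
      filter_upwards [self_mem_nhdsWithin] with ε (hε : 0 < ε)
      rw [abs_mul, abs_of_pos (Real.rpow_pos_of_pos hε r)]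
    refine squeeze_zero_norm' ?_ h2
    filter_upwards [self_mem_nhdsWithin] with ε (hε : 0 < ε)
    exact abs_log_mul_holder_le hD t x hε
  have h4 := (Real.continuous_exp.tendsto 0).comp h1
  rw [Real.exp_zero] at h4
  refine h4.congr' ?_
  filter_upwards [self_mem_nhdsWithin] with ε (hε : 0 < ε)
  rw [Real.rpow_def_of_pos hε]
  rfl

/-- Scaling preserves the order of the two times, hence the branch of `orderedR`; the remaining
powers of `ε` only involve differences of `h`. -/
lemma rpow_mul_kernel (t x y : ℝ) {ε : ℝ} (hε : 0 < ε) :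
    ε ^ (2 - h t - h t) * kernel R h (t + ε * x) (t + ε * y) =
      orderedR R x y (h (t + ε * x)) (h (t + ε * y)) *
        (ε ^ (h (t + ε * x) - h t) * ε ^ (h (t + ε * y) - h t)) *
          |x - y| ^ (h (t + ε * x) + h (t + ε * y) - 2) := by
  have h1 : orderedR R (t + ε * x) (t + ε * y) (h (t + ε * x)) (h (t + ε * y)) =
      orderedR R x y (h (t + ε * x)) (h (t + ε * y)) := by
    unfold orderedR
    simp only [add_le_add_iff_left, mul_le_mul_iff_right₀ hε]
  unfold kernel
  rw [h1, show t + ε * x - (t + ε * y) = ε * (x - y) by ring, abs_mul, abs_of_pos hε,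
    Real.mul_rpow hε.le (abs_nonneg _), ← Real.rpow_add hε]
  rw [show h (t + ε * x) - h t + (h (t + ε * y) - h t) =
    (2 - h t - h t) + (h (t + ε * x) + h (t + ε * y) - 2) by ring, Real.rpow_add hε]
  ring

lemma IsRegular.exists_rpow_mul_kernel_le (H : IsRegular a b R h) (N : ℝ) :
    ∃ C, 0 ≤ C ∧ ∀ t ε x y, 0 < ε → ε ≤ 1 → x ∈ Icc 0 N → y ∈ Icc 0 N →
      |ε ^ (2 - h t - h t) * kernel R h (t + ε * x) (t + ε * y)| ≤
        C * (1 + |x - y| ^ (2 * a - 2)) := by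
  obtain ⟨C, hC0, hC⟩ := H.bounded
  obtain ⟨B, hB0, hB⟩ := H.exists_rpow_le N
  refine ⟨C * (B * B), by positivity, fun t ε x y hε hε1 hx hy => ?_⟩
  rw [rpow_mul_kernel t x y hε, abs_mul, abs_mul, abs_of_nonneg (Real.rpow_nonneg (abs_nonneg _) _),
    abs_of_nonneg (mul_nonneg (Real.rpow_nonneg hε.le _) (Real.rpow_nonneg hε.le _))]
  have h1 := H.mem (t + ε * x)
  have h2 := H.mem (t + ε * y)
  have h3 := H.lt_one
  gcongr
  · exact abs_orderedR_le hC _ _ _ _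
  · exact hB t ε x hε hε1 hx.1 hx.2
  · exact hB t ε y hε hε1 hy.1 hy.2
  · exact rpow_le_one_add_rpow (abs_nonneg _) (by linarith [h1.1, h2.1]) (by linarith [h1.2, h2.2])

lemma IsRegular.tendsto_rpow_mul_kernel (H : IsRegular a b R h) (t x y : ℝ) :
    Tendsto (fun ε : ℝ => ε ^ (2 - h t - h t) * kernel R h (t + ε * x) (t + ε * y)) (𝓝[>] 0)
      (𝓝 (R (h t) (h t) * |x - y| ^ (2 * h t - 2))) := by
  have hlim : ∀ z : ℝ, Tendsto (fun ε : ℝ => h (t + ε * z)) (𝓝[>] 0) (𝓝 (h t)) := fun z => by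
    have hc : Continuous fun ε : ℝ => h (t + ε * z) := H.continuous_h.comp (by fun_prop)
    simpa using (hc.tendsto 0).mono_left nhdsWithin_le_nhds
  have h3 := H.lt_one
  have hRl : Tendsto (fun ε : ℝ => orderedR R x y (h (t + ε * x)) (h (t + ε * y))) (𝓝[>] 0)
      (𝓝 (R (h t) (h t))) := by
    unfold orderedR
    split_ifs
    · exact (H.continuous_R.tendsto (h t, h t)).comp ((hlim x).prodMk_nhds (hlim y))
    · exact (H.continuous_R.tendsto (h t, h t)).comp ((hlim y).prodMk_nhds (hlim x))
  have hpow : Tendsto (fun ε : ℝ => |x - y| ^ (h (t + ε * x) + h (t + ε * y) - 2)) (𝓝[>] 0)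
      (𝓝 (|x - y| ^ (2 * h t - 2))) := by
    -- On the diagonal all exponents are negative, so every power of `0` is `0` and the limit is
    -- trivial.
    rcases eq_or_ne x y with rfl | hxy
    · have h1 : ∀ ε : ℝ, |x - x| ^ (h (t + ε * x) + h (t + ε * x) - 2) = 0 := fun ε => by
        have := (H.mem (t + ε * x)).2
        rw [sub_self, abs_zero, Real.zero_rpow (by linarith)]
      have h2 : |x - x| ^ (2 * h t - 2) = 0 := by
        have := (H.mem t).2
        rw [sub_self, abs_zero, Real.zero_rpow (by linarith)]
      simp_rw [h1, h2]
      exact tendsto_const_nhds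
    · have hpos : 0 < |x - y| := abs_pos.2 (sub_ne_zero.2 hxy)
      refine ((Real.continuousAt_const_rpow hpos.ne').tendsto).comp ?_
      rw [two_mul]
      exact ((hlim x).add (hlim y)).sub_const 2
  have := (hRl.mul ((H.tendsto_rpow t x).mul (H.tendsto_rpow t y))).mul hpow
  rw [mul_one, mul_one] at this
  refine this.congr' ?_
  filter_upwards [self_mem_nhdsWithin] with ε (hε : 0 < ε)
  exact (rpow_mul_kernel t x y hε).symm

end KernelEstimates

/-! ### Covariance of the rescaled increments -/

section CovarianceEstimates

variable {a b : ℝ} {R : ℝ → ℝ → ℝ} {h : ℝ → ℝ}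

lemma continuous_integral_abs_sub_rpow {p : ℝ} (hp : -1 < p) (c d : ℝ) :
    Continuous fun x => ∫ y in c..d, |x - y| ^ p := by
  simp_rw [intervalIntegral.integral_comp_sub_left (fun z => |z| ^ p), integral_abs_rpow hp]
  exact ((continuous_abs_rpow_mul hp).comp (continuous_id.sub continuous_const)).sub
    ((continuous_abs_rpow_mul hp).comp (continuous_id.sub continuous_const))

/-- The mixed second difference of the limit covariance. -/
noncomputable def covIncrement (R : ℝ → ℝ → ℝ) (h : ℝ → ℝ) (t t' s s' : ℝ≥0) : ℝ :=
  limitCov R h t' s' - limitCov R h t' s - limitCov R h t s' + limitCov R h t s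

lemma IsRegular.covIncrement_eq (H : IsRegular a b R h) (t s ε u v u' v' : ℝ≥0) :
    covIncrement R h (t + ε * u) (t + ε * u') (s + ε * v) (s + ε * v') =
      (ε : ℝ) ^ 2 * ∫ x in (u : ℝ)..u', ∫ y in (v : ℝ)..v', kernel R h (t + ε * x) (s + ε * y) := by
  unfold covIncrement
  rw [H.limitCov_increments]
  push_cast
  exact integral_integral_comp_add_mul _ _ _ _ _ _ _ _

lemma IsRegular.covIncrement_div_eq (H : IsRegular a b R h) (t s u v u' v' : ℝ≥0) {ε : ℝ≥0}
    (hε : 0 < ε) :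
    covIncrement R h (t + ε * u) (t + ε * u') (s + ε * v) (s + ε * v') /
        ((ε : ℝ) ^ h t * (ε : ℝ) ^ h s) =
      ∫ x in (u : ℝ)..u', ∫ y in (v : ℝ)..v',
        (ε : ℝ) ^ (2 - h t - h s) * kernel R h (t + ε * x) (s + ε * y) := by
  have hε' : (0 : ℝ) < ε := hε
  simp_rw [intervalIntegral.integral_const_mul]
  rw [H.covIncrement_eq, Real.rpow_sub hε', Real.rpow_sub hε', Real.rpow_two]
  have h1 := (Real.rpow_pos_of_pos hε' (h t)).ne'
  have h2 := (Real.rpow_pos_of_pos hε' (h s)).ne'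
  field_simp

/-- The rescaled increments have variances controlled by a power larger than `1` of the length,
uniformly in the scale. -/
lemma IsRegular.exists_covIncrement_le (H : IsRegular a b R h) (N : ℝ) :
    ∃ C, 0 ≤ C ∧ ∀ t ε u v : ℝ≥0, 0 < ε → ε ≤ 1 → u ≤ v → v ≤ N → (v : ℝ) - u ≤ 1 →
      covIncrement R h (t + ε * u) (t + ε * v) (t + ε * u) (t + ε * v) /
        ((ε : ℝ) ^ h t * (ε : ℝ) ^ h t) ≤ C * ((v : ℝ) - u) ^ (2 * a) := by
  obtain ⟨C, hC0, hC⟩ := H.exists_rpow_mul_kernel_le N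
  have ha := H.half_lt
  have ha1 : a < 1 := ((H.mem 0).1.trans (H.mem 0).2).trans_lt H.lt_one
  have hden : 0 < (2 * a - 1) * (2 * a) := mul_pos (by linarith) (by linarith)
  -- The `1` comes from the constant part of the majorant, the fraction from the integral of `|x -
  -- y| ^ (2a - 2)` over the square.
  refine ⟨C * (1 + 2 / ((2 * a - 1) * (2 * a))), by positivity,
    fun t ε u v hε hε1 huv hv hd => ?_⟩
  have huv' : (u : ℝ) ≤ v := huv
  have hε' : (0 : ℝ) < ε := hε
  rw [H.covIncrement_div_eq t t u u v v hε]
  have hp := H.neg_one_lt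
  have hinner : ∀ x : ℝ, IntervalIntegrable (fun y => C * (1 + |x - y| ^ (2 * a - 2))) volume u v :=
    fun x => ((intervalIntegrable_const).add
      (intervalIntegrable_abs_sub_rpow hp x u v)).const_mul C
  have heq : ∀ x : ℝ, ∫ y in (u : ℝ)..v, C * (1 + |x - y| ^ (2 * a - 2)) =
      C * ((v - u) + ∫ y in (u : ℝ)..v, |x - y| ^ (2 * a - 2)) := fun x => by
    rw [intervalIntegral.integral_const_mul, intervalIntegral.integral_add
      intervalIntegrable_const (intervalIntegrable_abs_sub_rpow hp x u v)]
    simp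
  have hcont : Continuous fun x : ℝ => ∫ y in (u : ℝ)..v, |x - y| ^ (2 * a - 2) :=
    continuous_integral_abs_sub_rpow hp _ _
  have houter : IntervalIntegrable
      (fun x => ∫ y in (u : ℝ)..v, C * (1 + |x - y| ^ (2 * a - 2))) volume u v := by
    simp_rw [heq]
    exact (continuous_const.mul (continuous_const.add hcont)).intervalIntegrable _ _
  refine (Real.le_norm_self _).trans ((intervalIntegral.norm_integral_le_of_norm_le huv'
    (Eventually.of_forall fun x hx => intervalIntegral.norm_integral_le_of_norm_le huv'
      (Eventually.of_forall fun y hy => ?_) (hinner x)) houter).trans ?_)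
  · exact hC t ε x y hε' (by exact_mod_cast hε1) ⟨u.2.trans hx.1.le, hx.2.trans hv⟩
      ⟨u.2.trans hy.1.le, hy.2.trans hv⟩
  · simp_rw [heq]
    rw [intervalIntegral.integral_const_mul, intervalIntegral.integral_add
      intervalIntegrable_const (hcont.intervalIntegrable _ _),
      integral_integral_abs_sub_rpow hp, sub_self, sub_self, abs_zero,
      Real.zero_rpow (by linarith), abs_sub_comm (u : ℝ) v, abs_of_nonneg (sub_nonneg.2 huv')]
    simp only [intervalIntegral.integral_const, smul_eq_mul]
    rw [show 2 * a - 2 + 1 = 2 * a - 1 by ring, show 2 * a - 2 + 2 = 2 * a by ring, mul_assoc]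
    -- Here the length is at most `1` and `2a ≤ 2`.
    have hsq : ((v : ℝ) - u) * (v - u) ≤ (v - u) ^ (2 * a) := by
      rcases huv'.eq_or_lt with he | hlt
      · rw [he, sub_self, Real.zero_rpow (by linarith)]; simp
      · rw [← sq, ← Real.rpow_two]
        exact Real.rpow_le_rpow_of_exponent_ge (by linarith) hd (by linarith)
    gcongr
    calc ((v : ℝ) - u) * (v - u) +
          ((v - u) ^ (2 * a) - 0 - 0 + (v - u) ^ (2 * a)) / ((2 * a - 1) * (2 * a))
        ≤ (v - u) ^ (2 * a) +
          ((v - u) ^ (2 * a) - 0 - 0 + (v - u) ^ (2 * a)) / ((2 * a - 1) * (2 * a)) := by gcongr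
      _ = _ := by ring

/-- The covariance of the rescaled increments. -/
noncomputable def rescaledCov (R : ℝ → ℝ → ℝ) (h : ℝ → ℝ) (ε : ℝ≥0) (p q : ℝ≥0 × ℝ≥0) : ℝ :=
  covIncrement R h p.1 (p.1 + ε * p.2) q.1 (q.1 + ε * q.2) / ((ε : ℝ) ^ h p.1 * (ε : ℝ) ^ h q.1)

lemma IsRegular.rescaledCov_eq (H : IsRegular a b R h) (p q : ℝ≥0 × ℝ≥0) {ε : ℝ≥0} (hε : 0 < ε) :
    rescaledCov R h ε p q = ∫ x in (0 : ℝ)..p.2, ∫ y in (0 : ℝ)..q.2,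
        (ε : ℝ) ^ (2 - h p.1 - h q.1) * kernel R h (p.1 + ε * x) (q.1 + ε * y) := by
  have := H.covIncrement_div_eq p.1 q.1 0 0 p.2 q.2 hε
  simpa [rescaledCov] using this

/-- Dominated convergence on the rectangle, with Fubini before and after; the limit integral is
explicit. -/
lemma IsRegular.tendsto_integral_same (H : IsRegular a b R h) (t : ℝ) {u v : ℝ} (hu : 0 ≤ u)
    (hv : 0 ≤ v) :
    Tendsto (fun ε : ℝ => ∫ x in (0 : ℝ)..u, ∫ y in (0 : ℝ)..v,
        ε ^ (2 - h t - h t) * kernel R h (t + ε * x) (t + ε * y)) (𝓝[>] 0)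
      (𝓝 (R (h t) (h t) / (4 * h t ^ 2 - 2 * h t) *
        (u ^ (2 * h t) + v ^ (2 * h t) - |u - v| ^ (2 * h t)))) := by
  obtain ⟨C, hC0, hC⟩ := H.exists_rpow_mul_kernel_le (max u v)
  set F : ℝ → ℝ × ℝ → ℝ := fun ε q =>
    ε ^ (2 - h t - h t) * kernel R h (t + ε * q.1) (t + ε * q.2) with hF
  have hht : 1 / 2 < h t := H.half_lt.trans_le (H.mem t).1
  have hp : -1 < 2 * h t - 2 := by linarith
  have hmeas : ∀ ε, Measurable (F ε) := fun ε =>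
    (H.measurable_kernel.comp (f := fun q : ℝ × ℝ => (t + ε * q.1, t + ε * q.2))
      (by fun_prop)).const_mul _
  have hbound : ∀ ε : ℝ, 0 < ε → ε ≤ 1 → ∀ q ∈ Ioc 0 u ×ˢ Ioc 0 v,
      ‖F ε q‖ ≤ C * (1 + |q.1 - q.2| ^ (2 * a - 2)) := fun ε hε hε1 q hq =>
    hC t ε q.1 q.2 hε hε1 ⟨hq.1.1.le, hq.1.2.trans (le_max_left _ _)⟩
      ⟨hq.2.1.le, hq.2.2.trans (le_max_right _ _)⟩
  have hbi := integrableOn_const_mul_one_add_rpow H.neg_one_lt C 0 u 0 v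
  have hms : MeasurableSet (Ioc 0 u ×ˢ Ioc 0 v) := measurableSet_Ioc.prod measurableSet_Ioc
  have hev : ∀ᶠ ε : ℝ in 𝓝[>] 0, 0 < ε ∧ ε ≤ 1 := by
    filter_upwards [Ioc_mem_nhdsGT zero_lt_one] with ε hε using hε
  have hlim : Tendsto (fun ε => ∫ q in Ioc 0 u ×ˢ Ioc 0 v, F ε q) (𝓝[>] 0)
      (𝓝 (∫ q in Ioc 0 u ×ˢ Ioc 0 v, R (h t) (h t) * |q.1 - q.2| ^ (2 * h t - 2))) := by
    refine tendsto_integral_filter_of_dominated_convergence _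
      (Eventually.of_forall fun ε => (hmeas ε).aestronglyMeasurable) ?_ hbi
      (Eventually.of_forall fun q => H.tendsto_rpow_mul_kernel t q.1 q.2)
    filter_upwards [hev] with ε hε
    filter_upwards [ae_restrict_mem hms] with q hq using hbound ε hε.1 hε.2 q hq
  have hval : ∫ q in Ioc 0 u ×ˢ Ioc 0 v, R (h t) (h t) * |q.1 - q.2| ^ (2 * h t - 2) =
      R (h t) (h t) / (4 * h t ^ 2 - 2 * h t) *
        (u ^ (2 * h t) + v ^ (2 * h t) - |u - v| ^ (2 * h t)) := by
    rw [integral_const_mul]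
    have h1 := integrableOn_abs_sub_rpow hp 0 u 0 v
    rw [Measure.volume_eq_prod] at h1 ⊢
    rw [setIntegral_prod _ h1, ← intervalIntegral.integral_of_le hu]
    simp_rw [← intervalIntegral.integral_of_le hv]
    rw [integral_integral_abs_sub_rpow hp, show 2 * h t - 2 + 2 = 2 * h t by ring,
      show 2 * h t - 2 + 1 = 2 * h t - 1 by ring]
    simp only [sub_zero, zero_sub, abs_neg, abs_zero]
    rw [Real.zero_rpow (by linarith), abs_of_nonneg hu, abs_of_nonneg hv,
      show 4 * h t ^ 2 - 2 * h t = (2 * h t - 1) * (2 * h t) by ring]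
    ring
  rw [hval] at hlim
  refine hlim.congr' ?_
  filter_upwards [hev] with ε hε
  have hint : IntegrableOn (F ε) (Ioc 0 u ×ˢ Ioc 0 v) := by
    refine hbi.mono' (hmeas ε).aestronglyMeasurable ?_
    filter_upwards [ae_restrict_mem hms] with q hq using hbound ε hε.1 hε.2 q hq
  rw [Measure.volume_eq_prod] at hint ⊢
  rw [setIntegral_prod _ hint, intervalIntegral.integral_of_le hu]
  simp_rw [intervalIntegral.integral_of_le hv]
  rfl

/-- For small `ε` the two times stay at least `|t - s| / 2` apart, so the kernel is bounded and the
positive power of `ε` wins. -/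
lemma IsRegular.tendsto_integral_ne (H : IsRegular a b R h) {t s : ℝ} (hts : t ≠ s) {u v : ℝ}
    (hu : 0 ≤ u) (hv : 0 ≤ v) :
    Tendsto (fun ε : ℝ => ∫ x in (0 : ℝ)..u, ∫ y in (0 : ℝ)..v,
        ε ^ (2 - h t - h s) * kernel R h (t + ε * x) (s + ε * y)) (𝓝[>] 0) (𝓝 0) := by
  obtain ⟨C, hC0, hC⟩ := H.bounded
  set d := |t - s| / 2 with hd
  have hd0 : 0 < d := by
    have := abs_pos.2 (sub_ne_zero.2 hts)
    positivity
  have hexp : 0 < 2 - h t - h s := by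
    have := (H.mem t).2; have := (H.mem s).2; have := H.lt_one; linarith
  have hneg : 2 * a - 2 < 0 := by
    have := (H.mem t).1; have := (H.mem t).2; have := H.lt_one; linarith
  have hlim : Tendsto (fun ε : ℝ => ε ^ (2 - h t - h s) * (C * (1 + d ^ (2 * a - 2))) *
      |v - 0| * |u - 0|) (𝓝[>] 0) (𝓝 0) := by
    have h1 : Tendsto (fun ε : ℝ => ε ^ (2 - h t - h s)) (𝓝[>] 0) (𝓝 0) := by
      have := (Real.continuousAt_rpow_const 0 (2 - h t - h s) (Or.inr hexp.le)).tendsto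
      rw [Real.zero_rpow hexp.ne'] at this
      exact this.mono_left nhdsWithin_le_nhds
    simpa using ((h1.mul_const (C * (1 + d ^ (2 * a - 2)))).mul_const |v - 0|).mul_const |u - 0|
  have hsmall : ∀ᶠ ε : ℝ in 𝓝[>] 0, ε * (u + v) ≤ d := by
    have : Tendsto (fun ε : ℝ => ε * (u + v)) (𝓝[>] 0) (𝓝 (0 * (u + v))) :=
      (tendsto_id.mul_const (u + v)).mono_left nhdsWithin_le_nhds
    rw [zero_mul] at this
    exact this.eventually_le_const hd0
  refine squeeze_zero_norm' ?_ hlim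
  filter_upwards [self_mem_nhdsWithin, hsmall] with ε (hε : 0 < ε) hεd
  refine intervalIntegral.norm_integral_le_of_norm_le_const fun x hx =>
    intervalIntegral.norm_integral_le_of_norm_le_const fun y hy => ?_
  rw [uIoc_of_le hu] at hx
  rw [uIoc_of_le hv] at hy
  rw [norm_mul, Real.norm_eq_abs, abs_of_nonneg (Real.rpow_nonneg hε.le _)]
  gcongr
  refine (H.abs_kernel_le hC0 hC _ _).trans ?_
  have hle : d ≤ |t + ε * x - (s + ε * y)| := by
    have h1 : |t - s| ≤ |t + ε * x - (s + ε * y)| + |ε * (y - x)| := by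
      refine le_trans (le_of_eq ?_) (abs_add_le _ _)
      congr 1; ring
    have h2 : |ε * (y - x)| ≤ d := by
      rw [abs_mul, abs_of_pos hε]
      refine le_trans ?_ hεd
      gcongr
      rw [abs_le]
      constructor <;> linarith [hx.1, hx.2, hy.1, hy.2]
    linarith
  gcongr C * (1 + ?_)
  exact Real.rpow_le_rpow_of_nonpos hd0 hle hneg.le

lemma tendsto_coe_nhdsGT_zero : Tendsto ((↑) : ℝ≥0 → ℝ) (𝓝[>] 0) (𝓝[>] 0) := by
  refine tendsto_nhdsWithin_iff.2 ⟨?_, ?_⟩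
  · exact (NNReal.continuous_coe.tendsto 0).mono_left nhdsWithin_le_nhds
  · filter_upwards [self_mem_nhdsWithin] with ε (hε : 0 < ε) using hε

/-- The covariance of the rescaled increments converges to that of the tangent field. -/
lemma IsRegular.tendsto_rescaledCov (H : IsRegular a b R h) (p q : ℝ≥0 × ℝ≥0) :
    Tendsto (fun ε => rescaledCov R h ε p q) (𝓝[>] 0) (𝓝 (tangentCov R h p q)) := by
  obtain ⟨t, u⟩ := p
  obtain ⟨s, v⟩ := q
  have key : Tendsto (fun ε : ℝ => ∫ x in (0 : ℝ)..u, ∫ y in (0 : ℝ)..v,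
      ε ^ (2 - h t - h s) * kernel R h (t + ε * x) (s + ε * y)) (𝓝[>] 0)
      (𝓝 (tangentCov R h (t, u) (s, v))) := by
    unfold tangentCov
    split_ifs with hts
    · simp only at hts
      subst hts
      exact H.tendsto_integral_same t u.2 v.2
    · exact H.tendsto_integral_ne (fun h => hts (NNReal.coe_injective h)) u.2 v.2
  refine (key.comp tendsto_coe_nhdsGT_zero).congr' ?_
  filter_upwards [self_mem_nhdsWithin] with ε (hε : 0 < ε)
  exact (H.rescaledCov_eq (t, u) (s, v) hε).symm

end CovarianceEstimates

/-! ### Characteristic functions of Gaussian processes -/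

section GaussianCharFun

variable {Ω ι : Type*} [MeasurableSpace Ω] {P : Measure Ω} {X : ι → Ω → ℝ} {K : ι → ι → ℝ}

lemma IsCenteredGaussianWithCov.memLp_two (hX : IsCenteredGaussianWithCov X K P) (i : ι) :
    MemLp (X i) 2 P := (hX.gaussian.hasGaussianLaw_eval i).memLp_two

lemma IsCenteredGaussianWithCov.aemeasurable (hX : IsCenteredGaussianWithCov X K P) (i : ι) :
    AEMeasurable (X i) P := hX.gaussian.aemeasurable i

lemma IsCenteredGaussianWithCov.integral_sum_sq (hX : IsCenteredGaussianWithCov X K P)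
    {κ : Type*} [Fintype κ] (f : κ → ι) (w : κ → ℝ) :
    ∫ ω, (∑ k, w k * X (f k) ω) ^ 2 ∂P = ∑ k, ∑ l, w k * w l * K (f k) (f l) := by
  have hint : ∀ k l, Integrable (fun ω => w k * w l * (X (f k) ω * X (f l) ω)) P := fun k l =>
    ((hX.memLp_two (f k)).integrable_mul (hX.memLp_two (f l))).const_mul _
  have h1 : ∀ ω, (∑ k, w k * X (f k) ω) ^ 2 =
      ∑ k, ∑ l, w k * w l * (X (f k) ω * X (f l) ω) := fun ω => by
    rw [sq, Finset.sum_mul_sum]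
    exact Finset.sum_congr rfl fun k _ => Finset.sum_congr rfl fun l _ => by ring
  simp_rw [h1]
  rw [integral_finsetSum _ fun k _ => integrable_finsetSum _ fun l _ => hint k l]
  refine Finset.sum_congr rfl fun k _ => ?_
  rw [integral_finsetSum _ fun l _ => hint k l]
  refine Finset.sum_congr rfl fun l _ => ?_
  rw [integral_const_mul, hX.cov]

lemma IsCenteredGaussianWithCov.map_sum (hX : IsCenteredGaussianWithCov X K P)
    {κ : Type*} [Fintype κ] (f : κ → ι) (w : κ → ℝ) :
    P.map (fun ω => ∑ k, w k * X (f k) ω) =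
      gaussianReal 0 (∑ k, ∑ l, w k * w l * K (f k) (f l)).toNNReal := by
  have hG : HasGaussianLaw (fun ω => ∑ k, w k * X (f k) ω) P :=
    ((hX.gaussian.comp_right f).smul w).hasGaussianLaw_fun_sum (I := Finset.univ)
  have hmean : ∫ ω, ∑ k, w k * X (f k) ω ∂P = 0 := by
    rw [integral_finsetSum _ fun k _ =>
      ((hX.gaussian.hasGaussianLaw_eval (f k)).integrable).const_mul (w k)]
    simp [integral_const_mul, hX.centered]
  rw [hG.map_eq_gaussianReal, hmean, variance_of_integral_eq_zero hG.aemeasurable hmean]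
  simp_rw [hX.integral_sum_sq]

/-- The characteristic function of a centered Gaussian process. -/
lemma IsCenteredGaussianWithCov.integral_cexp (hX : IsCenteredGaussianWithCov X K P)
    {κ : Type*} [Fintype κ] (f : κ → ι) (w : κ → ℝ) :
    ∫ ω, Complex.exp ((∑ k, w k * X (f k) ω : ℝ) * Complex.I) ∂P =
      Complex.exp (-((∑ k, ∑ l, w k * w l * K (f k) (f l) : ℝ) : ℂ) / 2) := by
  -- Nonnegativity of the quadratic form comes from its being a second moment; thus `toNNReal`
  -- truncates nothing.
  have h0 : 0 ≤ ∑ k, ∑ l, w k * w l * K (f k) (f l) := by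
    rw [← hX.integral_sum_sq]
    exact integral_nonneg fun ω => sq_nonneg _
  have h1 := charFun_gaussianReal (μ := 0)
    (v := (∑ k, ∑ l, w k * w l * K (f k) (f l)).toNNReal) 1
  rw [← hX.map_sum, charFun_apply_real, integral_map] at h1
  · simp only [Complex.ofReal_one, one_mul] at h1
    rw [h1, Real.coe_toNNReal _ h0]
    congr 1
    push_cast
    ring
  · exact Finset.aemeasurable_fun_sum _ fun k _ => (hX.aemeasurable (f k)).const_mul (w k)
  · fun_prop

/-- A characteristic function has modulus at most `1`, which at `t = 1` forces `q ≥ 0`. Positivity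
of the limit covariance therefore need not be known in advance. -/
lemma map_eq_gaussianReal_of_integral_cexp [IsProbabilityMeasure P] {Z : Ω → ℝ}
    (hZ : AEMeasurable Z P) {q : ℝ}
    (h : ∀ t : ℝ, ∫ ω, Complex.exp ((t * Z ω : ℝ) * Complex.I) ∂P =
      Complex.exp (-((t ^ 2 * q : ℝ) : ℂ) / 2)) :
    0 ≤ q ∧ P.map Z = gaussianReal 0 q.toNNReal := by
  have hq : 0 ≤ q := by
    have h1 : ‖∫ ω, Complex.exp ((1 * Z ω : ℝ) * Complex.I) ∂P‖ ≤ 1 := by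
      refine (norm_integral_le_of_norm_le_const (C := 1) ?_).trans (by simp)
      exact Eventually.of_forall fun ω => (Complex.norm_exp_ofReal_mul_I _).le
    rw [h 1, Complex.norm_exp, Real.exp_le_one_iff] at h1
    have h2 : (-((1 ^ 2 * q : ℝ) : ℂ) / 2).re = -q / 2 := by
      rw [show (-((1 ^ 2 * q : ℝ) : ℂ) / 2) = ((-q / 2 : ℝ) : ℂ) by push_cast; ring]
      exact Complex.ofReal_re _
    rw [h2] at h1
    linarith
  refine ⟨hq, ?_⟩
  have := Measure.isProbabilityMeasure_map hZ
  refine Measure.ext_of_charFun (funext fun t => ?_)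
  rw [charFun_apply_real, integral_map hZ (by fun_prop), charFun_gaussianReal,
    Real.coe_toNNReal _ hq]
  have h1 := h t
  push_cast at h1
  rw [h1]
  congr 1
  push_cast
  ring

/-- A process with the characteristic function of a centered Gaussian process is one. -/
lemma IsCenteredGaussianWithCov.of_integral_cexp [IsProbabilityMeasure P]
    (hX : ∀ i, AEMeasurable (X i) P) (hK : ∀ i j, K i j = K j i)
    (h : ∀ (s : Finset ι) (w : s → ℝ),
      ∫ ω, Complex.exp ((∑ k, w k * X k ω : ℝ) * Complex.I) ∂P =
        Complex.exp (-((∑ k, ∑ l, w k * w l * K k l : ℝ) : ℂ) / 2)) :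
    IsCenteredGaussianWithCov X K P := by
  classical
  have hZm : ∀ (s : Finset ι) (w : s → ℝ), AEMeasurable (fun ω => ∑ k, w k * X k ω) P :=
    fun s w => Finset.aemeasurable_fun_sum _ fun k _ => (hX k).const_mul (w k)
  have key : ∀ (s : Finset ι) (w : s → ℝ), 0 ≤ ∑ k, ∑ l, w k * w l * K k l ∧
      P.map (fun ω => ∑ k, w k * X k ω) =
        gaussianReal 0 (∑ k, ∑ l, w k * w l * K k l).toNNReal := fun s w => by
    refine map_eq_gaussianReal_of_integral_cexp (hZm s w) fun t => ?_
    have h1 := h s fun k => t * w k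
    simp_rw [mul_assoc, ← Finset.mul_sum] at h1 ⊢
    rw [h1]
    congr 4
    simp_rw [Finset.mul_sum]
    refine Finset.sum_congr rfl fun k _ => Finset.sum_congr rfl fun l _ => by ring
  have hG : IsGaussianProcess X P := by
    -- A vector is Gaussian once all its linear functionals are, and these are the weighted sums of
    -- coordinates treated in `key`.
    refine ⟨fun I => ⟨isGaussian_of_map_eq_gaussianReal fun L => ?_⟩⟩
    have hL : ∀ x : I → ℝ, L x = ∑ k, L (Pi.single k 1) * x k := fun x => by
      conv_lhs => rw [← Finset.univ_sum_single x, _root_.map_sum]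
      refine Finset.sum_congr rfl fun k _ => ?_
      rw [show (Pi.single k (x k) : I → ℝ) = x k • Pi.single k 1 by
        rw [← Pi.single_smul', smul_eq_mul, mul_one], map_smul, smul_eq_mul, mul_comm]
    refine ⟨0, (∑ k, ∑ l, L (Pi.single k 1) * L (Pi.single l 1) * K k l).toNNReal, ?_⟩
    rw [AEMeasurable.map_map_of_aemeasurable L.continuous.measurable.aemeasurable
      (aemeasurable_pi_lambda (fun ω => I.restrict (X · ω)) fun k : I => hX k),
      ← (key I fun k => L (Pi.single k 1)).2]
    congr 1
    ext ω
    exact hL _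
  have hmem : ∀ i, MemLp (X i) 2 P := fun i => (hG.hasGaussianLaw_eval i).memLp_two
  have hsq : ∀ (s : Finset ι) (w : s → ℝ),
      ∫ ω, (∑ k, w k * X k ω) ^ 2 ∂P = ∑ k, ∑ l, w k * w l * K k l := fun s w => by
    have h1 := variance_id_gaussianReal (μ := 0)
      (v := (∑ k, ∑ l, w k * w l * K k l).toNNReal)
    have h0 : (gaussianReal 0 (∑ k, ∑ l, w k * w l * K k l).toNNReal)[id] = 0 := by
      simp
    rw [variance_of_integral_eq_zero (by fun_prop) h0, ← (key s w).2,
      integral_map (hZm s w) (by fun_prop), Real.coe_toNNReal _ (key s w).1] at h1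
    exact h1
  have hself : ∀ i, ∫ ω, X i ω * X i ω ∂P = K i i := fun i => by
    have := hsq {i} fun _ => 1
    simpa [Finset.univ_unique, sq] using this
  refine ⟨hG, fun i => ?_, fun i j => ?_⟩
  · have h1 := (key {i} fun _ => 1).2
    have h2 := congrArg (fun μ : Measure ℝ => ∫ x, x ∂μ) h1
    simp only [integral_id_gaussianReal] at h2
    rw [integral_map (hZm _ _) (by fun_prop)] at h2
    simpa [Finset.univ_unique] using h2
  -- Off the diagonal the covariance is recovered by polarisation from the variance of `X i + X j`.
  · rcases eq_or_ne i j with rfl | hij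
    · exact hself i
    · have h1 := hsq {i, j} fun _ => 1
      have e1 : ∀ F : ι → ℝ, ∑ k : ({i, j} : Finset ι), F k = F i + F j := fun F => by
        rw [Finset.sum_coe_sort {i, j} F, Finset.sum_pair hij]
      simp only [one_mul] at h1
      have e2 : ∀ ω, ∑ k : ({i, j} : Finset ι), X k ω = X i ω + X j ω :=
        fun ω => e1 fun k => X k ω
      simp_rw [e2] at h1
      rw [e1 fun k => ∑ l : ({i, j} : Finset ι), K k l, e1 fun l => K i l, e1 fun l => K j l] at h1
      have h2 : ∀ ω, (X i ω + X j ω) ^ 2 =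
          X i ω * X i ω + X j ω * X j ω + 2 * (X i ω * X j ω) := fun ω => by ring
      simp_rw [h2] at h1
      have hi : ∀ i j, Integrable (fun ω => X i ω * X j ω) P :=
        fun i j => (hmem i).integrable_mul (hmem j)
      have hij' : Integrable (fun ω => X i ω * X i ω + X j ω * X j ω) P := (hi i i).add (hi j j)
      rw [integral_add hij' ((hi i j).const_mul 2),
        integral_add (hi i i) (hi j j), integral_const_mul, hself, hself, hK j i] at h1
      linarith

lemma IsCenteredGaussianWithCov.charFun_toLp (hX : IsCenteredGaussianWithCov X K P)
    (I : Finset ι) (t : EuclideanSpace ℝ I) :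
    charFun (P.map fun ω => WithLp.toLp 2 fun i : I => X i ω) t =
      Complex.exp (-((∑ k, ∑ l, t k * t l * K k l : ℝ) : ℂ) / 2) := by
  have hm : AEMeasurable (fun ω => WithLp.toLp 2 fun i : I => X i ω) P :=
    (by fun_prop : Measurable (WithLp.toLp 2 : (I → ℝ) → EuclideanSpace ℝ I)).comp_aemeasurable
      (aemeasurable_pi_lambda _ fun i => hX.aemeasurable i)
  rw [← hX.integral_cexp (fun i : I => (i : ι)) t, charFun_apply, integral_map hm (by fun_prop)]
  simp [PiLp.inner_apply]

/-- Centered Gaussian processes with converging covariances converge in the sense of the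
finite-dimensional distributions. -/
lemma IsCenteredGaussianWithCov.tendstoInDistribution {Ω' τ : Type*} [MeasurableSpace Ω']
    [IsProbabilityMeasure P]
    {P' : Measure Ω'} [IsProbabilityMeasure P'] {l : Filter τ} [l.IsCountablyGenerated]
    {X : τ → ι → Ω → ℝ} {Kt : τ → ι → ι → ℝ} {Y : ι → Ω' → ℝ}
    (hX : ∀ ε, IsCenteredGaussianWithCov (X ε) (Kt ε) P) (hY : IsCenteredGaussianWithCov Y K P')
    (hK : ∀ i j, Tendsto (fun ε => Kt ε i j) l (𝓝 (K i j))) (I : Finset ι) :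
    TendstoInDistribution (fun ε ω (i : I) => X ε i ω) l (fun ω (i : I) => Y i ω)
      (fun _ => P) P' := by
  have hXm : ∀ ε, AEMeasurable (fun ω => WithLp.toLp 2 fun i : I => X ε i ω) P := fun ε =>
    (by fun_prop : Measurable (WithLp.toLp 2 : (I → ℝ) → EuclideanSpace ℝ I)).comp_aemeasurable
      (aemeasurable_pi_lambda _ fun i => (hX ε).aemeasurable i)
  have hYm : AEMeasurable (fun ω => WithLp.toLp 2 fun i : I => Y i ω) P' :=
    (by fun_prop : Measurable (WithLp.toLp 2 : (I → ℝ) → EuclideanSpace ℝ I)).comp_aemeasurable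
      (aemeasurable_pi_lambda _ fun i => hY.aemeasurable i)
  have main : TendstoInDistribution (fun ε ω => WithLp.toLp 2 fun i : I => X ε i ω) l
      (fun ω => WithLp.toLp 2 fun i : I => Y i ω) (fun _ => P) P' := by
    -- Lévy's continuity theorem is applied along sequences, which suffices as `l` is countably
    -- generated.
    refine ⟨hXm, hYm, tendsto_of_seq_tendsto fun x hx => ?_⟩
    refine ProbabilityMeasure.tendsto_of_tendsto_charFun fun t => ?_
    change Tendsto
      (fun n => charFun (P.map fun ω => WithLp.toLp 2 fun i : I => X (x n) i ω) t) atTop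
      (𝓝 (charFun (P'.map fun ω => WithLp.toLp 2 fun i : I => Y i ω) t))
    rw [hY.charFun_toLp]
    refine Tendsto.congr (fun n => ((hX (x n)).charFun_toLp I t).symm) ?_
    refine (Complex.continuous_exp.tendsto _).comp (Tendsto.div_const (Tendsto.neg ?_) 2)
    refine (Complex.continuous_ofReal.tendsto _).comp ?_
    exact tendsto_finsetSum _ fun k _ => tendsto_finsetSum _ fun l _ =>
      ((hK k l).comp hx).const_mul _
  exact main.continuous_comp (g := WithLp.ofLp) (by fun_prop)

end GaussianCharFun

/-! ### Kolmogorov's criterion and tightness -/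

section Moments

variable {Ω : Type*} [MeasurableSpace Ω] {P : Measure Ω}

lemma measureReal_le_abs_le [IsFiniteMeasure P] {Z : Ω → ℝ} (hZ : MemLp Z 2 P) {c : ℝ}
    (hc : 0 < c) : P.real {ω | c ≤ |Z ω|} ≤ (∫ ω, Z ω ^ 2 ∂P) / c ^ 2 := by
  rw [le_div_iff₀ (by positivity), mul_comm]
  have h := mul_meas_ge_le_integral_of_nonneg (μ := P) (f := fun ω => Z ω ^ 2)
    (Eventually.of_forall fun ω => sq_nonneg _) hZ.integrable_sq (c ^ 2)
  have hset : {ω | c ≤ |Z ω|} = {ω | c ^ 2 ≤ Z ω ^ 2} := by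
    ext ω
    change c ≤ |Z ω| ↔ c ^ 2 ≤ Z ω ^ 2
    rw [sq_le_sq, abs_of_pos hc]
  rwa [hset]

/-- The second moments of the increments of `X` over the dyadic intervals of length `2⁻ᵐ` in
`[0, N]` are bounded by `C N * τ ^ m`. -/
def DyadicMomentBound (C : ℕ → ℝ) (τ : ℝ) (X : ℝ≥0 → Ω → ℝ) (P : Measure Ω) : Prop :=
  ∀ N m k : ℕ, k + 1 ≤ N * 2 ^ m →
    MemLp (fun ω => X ((k + 1 : ℕ) / 2 ^ m) ω - X ((k : ℕ) / 2 ^ m) ω) 2 P ∧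
      ∫ ω, (X ((k + 1 : ℕ) / 2 ^ m) ω - X ((k : ℕ) / 2 ^ m) ω) ^ 2 ∂P ≤ C N * τ ^ m

/-- Chebyshev on each of the `N * 2 ^ m` intervals of level `m` gives a geometric series of ratio
`2τ / ρ ^ 2 < 1`. `M N` is so large that the failure on `[0, N]` costs at most `δ * 2⁻ᴺ / 2`; these
sum to `δ`. -/
lemma DyadicMomentBound.measure_not_dyadicBound_le [IsProbabilityMeasure P] {C : ℕ → ℝ} {τ ρ : ℝ}
    {X : ℝ≥0 → Ω → ℝ} (hX : DyadicMomentBound C τ X P) (hC : ∀ N, 0 ≤ C N) (hτ : 0 ≤ τ)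
    (hρ : 0 < ρ) (hτρ : 2 * τ < ρ ^ 2) {δ : ℝ} (hδ : 0 < δ) {M : ℕ → ℝ} (hM : ∀ N, 0 < M N)
    (hMC : ∀ N, N * C N / (1 - 2 * τ / ρ ^ 2) * (2 * 2 ^ N) / δ ≤ M N ^ 2) :
    P {ω | ¬ DyadicBound ρ M (X · ω)} ≤ ENNReal.ofReal δ := by
  set θ := 2 * τ / ρ ^ 2 with hθ
  have hθ0 : 0 ≤ θ := by positivity
  have hθ1 : θ < 1 := by rw [hθ, div_lt_one (by positivity)]; exact hτρ
  let A : ℕ → ℕ → ℕ → Set Ω := fun N m k =>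
    {ω | M N * ρ ^ m ≤ |X ((k + 1 : ℕ) / 2 ^ m) ω - X ((k : ℕ) / 2 ^ m) ω|}
  have hsub : {ω | ¬ DyadicBound ρ M (X · ω)} ⊆
      ⋃ N : ℕ, ⋃ m : ℕ, ⋃ k ∈ Finset.range (N * 2 ^ m), A N m k := by
    intro ω hω
    change ¬ DyadicBound ρ M (X · ω) at hω
    unfold DyadicBound at hω
    push Not at hω
    obtain ⟨N, m, k, hk, h⟩ := hω
    simp only [mem_iUnion, Finset.mem_range]
    exact ⟨N, m, k, hk, h.le⟩
  have hA : ∀ N m k, k ∈ Finset.range (N * 2 ^ m) →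
      P (A N m k) ≤ ENNReal.ofReal (C N * τ ^ m / (M N * ρ ^ m) ^ 2) := by
    intro N m k hk
    obtain ⟨h1, h2⟩ := hX N m k (Finset.mem_range.1 hk)
    have hpos : 0 < M N * ρ ^ m := mul_pos (hM N) (by positivity)
    have h3 := measureReal_le_abs_le h1 hpos
    rw [← ofReal_measureReal (measure_ne_top P _)]
    exact ENNReal.ofReal_le_ofReal (h3.trans (by gcongr))
  have hm : ∀ N m, P (⋃ k ∈ Finset.range (N * 2 ^ m), A N m k) ≤
      ENNReal.ofReal (N * C N / M N ^ 2 * θ ^ m) := by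
    intro N m
    refine (measure_biUnion_finset_le _ _).trans ((Finset.sum_le_sum (hA N m)).trans_eq ?_)
    rw [Finset.sum_const, Finset.card_range, nsmul_eq_mul, ← ENNReal.ofReal_natCast,
      ← ENNReal.ofReal_mul (by positivity)]
    congr 1
    have := (hM N).ne'
    rw [hθ, div_pow, mul_pow]
    push_cast
    field_simp
    ring
  have hN : ∀ N, P (⋃ m : ℕ, ⋃ k ∈ Finset.range (N * 2 ^ m), A N m k) ≤
      ENNReal.ofReal (δ * (1 / 2) ^ N / 2) := by
    intro N
    refine (measure_iUnion_le _).trans ((ENNReal.tsum_le_tsum (hm N)).trans ?_)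
    have hC' := hC N
    rw [← ENNReal.ofReal_tsum_of_nonneg (fun m => by positivity)
      ((summable_geometric_of_lt_one hθ0 hθ1).mul_left _), tsum_mul_left,
      tsum_geometric_of_lt_one hθ0 hθ1]
    refine ENNReal.ofReal_le_ofReal ?_
    have h1 := hMC N
    have hM2 : 0 < M N ^ 2 := by have := hM N; positivity
    rw [div_le_iff₀ hδ] at h1
    rw [div_mul_eq_mul_div, div_le_iff₀ hM2, ← div_eq_mul_inv]
    have e : δ * (1 / 2) ^ N / 2 * M N ^ 2 = M N ^ 2 * δ / (2 * 2 ^ N) := by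
      rw [one_div, inv_pow]
      field_simp
    rw [e, le_div_iff₀ (by positivity)]
    exact h1
  refine (measure_mono hsub).trans ((measure_iUnion_le _).trans
    ((ENNReal.tsum_le_tsum hN).trans_eq ?_))
  have hgeo : ∀ N : ℕ, δ * (1 / 2 : ℝ) ^ N / 2 = δ / 2 * (1 / 2) ^ N := fun N => by ring
  simp_rw [hgeo]
  rw [← ENNReal.ofReal_tsum_of_nonneg (fun m => by positivity)
    (summable_geometric_two.mul_left _), tsum_mul_left, tsum_geometric_two]
  congr 1
  ring

/-- The constants with which the dyadic bounds hold up to an event of probability at most `δ`. -/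
noncomputable def dyadicConst (C : ℕ → ℝ) (τ ρ δ : ℝ) (N : ℕ) : ℝ :=
  √(N * C N / (1 - 2 * τ / ρ ^ 2) * (2 * 2 ^ N) / δ) + 1

lemma dyadicConst_pos (C : ℕ → ℝ) (τ ρ δ : ℝ) (N : ℕ) : 0 < dyadicConst C τ ρ δ N := by
  unfold dyadicConst
  positivity

/-- The square of `√x + 1` exceeds `x`; the summand `1` keeps the constant positive when `x = 0`, as
for `N = 0`. -/
lemma DyadicMomentBound.measure_not_dyadicBound_dyadicConst_le [IsProbabilityMeasure P]
    {C : ℕ → ℝ} {τ ρ : ℝ}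
    {X : ℝ≥0 → Ω → ℝ} (hX : DyadicMomentBound C τ X P) (hC : ∀ N, 0 ≤ C N) (hτ : 0 ≤ τ)
    (hρ : 0 < ρ) (hτρ : 2 * τ < ρ ^ 2) {δ : ℝ} (hδ : 0 < δ) :
    P {ω | ¬ DyadicBound ρ (dyadicConst C τ ρ δ) (X · ω)} ≤ ENNReal.ofReal δ := by
  refine hX.measure_not_dyadicBound_le hC hτ hρ hτρ hδ (dyadicConst_pos C τ ρ δ) fun N => ?_
  unfold dyadicConst
  have hN := hC N
  have h1 : 0 < 1 - 2 * τ / ρ ^ 2 := by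
    rw [sub_pos, div_lt_one (by positivity)]; exact hτρ
  have h2 : 0 ≤ N * C N / (1 - 2 * τ / ρ ^ 2) * (2 * 2 ^ N) / δ := by positivity
  have h3 := Real.sq_sqrt h2
  have h4 := Real.sqrt_nonneg (N * C N / (1 - 2 * τ / ρ ^ 2) * (2 * 2 ^ N) / δ)
  nlinarith

/-- Chaining needs `ρ < 1`, the union bound needs `2τ < ρ ^ 2`; the midpoint of `2τ` and `1` serves
as `ρ ^ 2`. -/
lemma exists_ratio {τ : ℝ} (hτ : 0 ≤ τ) (hτ1 : 2 * τ < 1) :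
    ∃ ρ : ℝ, 0 < ρ ∧ ρ < 1 ∧ 2 * τ < ρ ^ 2 := by
  refine ⟨√((1 + 2 * τ) / 2), Real.sqrt_pos.2 (by linarith), ?_, ?_⟩
  · rw [Real.sqrt_lt' one_pos]; linarith
  · rw [Real.sq_sqrt (by linarith)]; linarith

/-- A process with dyadic moment bounds which is continuous in `L²` has a continuous
modification (**Kolmogorov's continuity criterion**). -/
lemma DyadicMomentBound.exists_isContinuousModification [IsProbabilityMeasure P]
    {C : ℕ → ℝ} {τ : ℝ}
    {X : ℝ≥0 → Ω → ℝ} (hX : DyadicMomentBound C τ X P) (hC : ∀ N, 0 ≤ C N) (hτ : 0 ≤ τ)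
    (hτ1 : 2 * τ < 1) (hmem : ∀ t, MemLp (X t) 2 P)
    (hL2 : ∀ t, Tendsto (fun m => ∫ ω, (X (dyadicFloor m t) ω - X t ω) ^ 2 ∂P) atTop (𝓝 0)) :
    ∃ Y : Ω → C(ℝ≥0, ℝ), IsContinuousModification Y X P := by
  obtain ⟨ρ, hρ, hρ1, hτρ⟩ := exists_ratio hτ hτ1
  have hgood : ∀ᵐ ω ∂P, ∃ f : C(ℝ≥0, ℝ), ∀ t,
      Tendsto (fun m => X (dyadicFloor m t) ω) atTop (𝓝 (f t)) := by
    have h1 : ∀ n : ℕ, P {ω | ¬ ∃ f : C(ℝ≥0, ℝ), ∀ t,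
        Tendsto (fun m => X (dyadicFloor m t) ω) atTop (𝓝 (f t))} ≤
          ENNReal.ofReal (1 / (n + 1 : ℝ)) := fun n => by
      refine le_trans (measure_mono fun ω hω => ?_)
        (hX.measure_not_dyadicBound_dyadicConst_le hC hτ hρ hτρ (δ := 1 / (n + 1 : ℝ))
          (by positivity))
      exact fun hω' => hω (hω'.exists_continuousMap hρ.le hρ1
        fun N => (dyadicConst_pos C τ ρ _ N).le)
    rw [ae_iff]
    have h2 := ENNReal.tendsto_ofReal (tendsto_one_div_add_atTop_nhds_zero_nat (𝕜 := ℝ))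
    rw [ENNReal.ofReal_zero] at h2
    exact le_antisymm (ge_of_tendsto' h2 h1) zero_le
  classical
  let Y : Ω → C(ℝ≥0, ℝ) := fun ω =>
    if hω : ∃ f : C(ℝ≥0, ℝ), ∀ t, Tendsto (fun m => X (dyadicFloor m t) ω) atTop (𝓝 (f t))
    then hω.choose else 0
  refine ⟨Y, fun t => ?_⟩
  -- Convergence in `L²` gives almost sure convergence along a subsequence, which identifies the
  -- pathwise dyadic limit with `X t`.
  have hmeas : TendstoInMeasure P (fun m => X (dyadicFloor m t)) atTop (X t) := by
    rw [tendstoInMeasure_iff_measureReal_norm]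
    intro ε hε
    refine squeeze_zero (fun m => measureReal_nonneg) (fun m => ?_)
      (by simpa using (hL2 t).div_const (ε ^ 2))
    exact measureReal_le_abs_le ((hmem _).sub (hmem _)) hε
  obtain ⟨ns, hns, hlim⟩ := hmeas.exists_seq_tendsto_ae
  filter_upwards [hgood, hlim] with ω h1 h2
  have h3 : Tendsto (fun m => X (dyadicFloor m t) ω) atTop (𝓝 (Y ω t)) := by
    simp only [Y, dif_pos h1]
    exact h1.choose_spec t
  exact tendsto_nhds_unique (h3.comp hns.tendsto_atTop) h2

/-- A family of random paths started at `0` with common dyadic moment bounds is tight. -/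
lemma isTightMeasureSet_of_dyadicMomentBound [IsProbabilityMeasure P] {ι : Type*}
    {C : ℕ → ℝ} {τ : ℝ} {Y : ι → Ω → C(ℝ≥0, ℝ)} (hY : ∀ i, AEMeasurable (Y i) P)
    (hY0 : ∀ i ω, Y i ω 0 = 0)
    (hm : ∀ i, DyadicMomentBound C τ (fun t ω => Y i ω t) P) (hC : ∀ N, 0 ≤ C N) (hτ : 0 ≤ τ)
    (hτ1 : 2 * τ < 1) : IsTightMeasureSet {P.map (Y i) | i} := by
  obtain ⟨ρ, hρ, hρ1, hτρ⟩ := exists_ratio hτ hτ1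
  rw [isTightMeasureSet_iff_exists_isCompact_measure_compl_le]
  intro ε hε
  obtain ⟨δ, hδ, hδε⟩ : ∃ δ : ℝ, 0 < δ ∧ ENNReal.ofReal δ ≤ ε := by
    rcases eq_or_ne ε ⊤ with rfl | htop
    · exact ⟨1, one_pos, le_top⟩
    · exact ⟨ε.toReal, ENNReal.toReal_pos hε.ne' htop, (ENNReal.ofReal_toReal htop).le⟩
  have hK := isCompact_setOf_dyadicBound hρ.le hρ1 (M := dyadicConst C τ ρ δ)
    fun N => (dyadicConst_pos C τ ρ δ N).le
  refine ⟨_, hK, ?_⟩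
  rintro _ ⟨i, rfl⟩
  rw [Measure.map_apply_of_aemeasurable (hY i) hK.isClosed.measurableSet.compl]
  refine le_trans (measure_mono fun ω hω hω' => hω ⟨hY0 i ω, hω'⟩)
    (((hm i).measure_not_dyadicBound_dyadicConst_le hC hτ hρ hτρ hδ).trans hδε)

end Moments

/-! ### Weak convergence on path space -/

section WeakConvergence

/-- The pairing of paths with finitely supported measures. -/
noncomputable def pathPairing : C(ℝ≥0, ℝ) →ₗ[ℝ] (ℝ≥0 →₀ ℝ) →ₗ[ℝ] ℝ :=
  LinearMap.mk₂ ℝ (fun f w => Finsupp.linearCombination ℝ f w)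
    (fun f g w => by simp [Finsupp.linearCombination_apply, Finsupp.sum, mul_add,
      Finset.sum_add_distrib])
    (fun c f w => by
      simp only [Finsupp.linearCombination_apply, Finsupp.sum, ContinuousMap.coe_smul,
        Pi.smul_apply, smul_eq_mul, Finset.mul_sum]
      exact Finset.sum_congr rfl fun _ _ => by ring)
    (fun f w w' => map_add _ _ _) (fun c f w => map_smul _ _ _)

lemma pathPairing_apply (f : C(ℝ≥0, ℝ)) (w : ℝ≥0 →₀ ℝ) :
    pathPairing f w = ∑ i ∈ w.support, w i * f i := rfl

/-- A tight family of laws on path space whose finite-dimensional characteristic functions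
converge has a limit. -/
lemma exists_tendsto_of_tight {τ : Type*} {l : Filter τ} [l.NeBot]
    {μ : τ → ProbabilityMeasure C(ℝ≥0, ℝ)}
    (hμ : IsTightMeasureSet {(μ n : Measure C(ℝ≥0, ℝ)) | n}) {φ : (ℝ≥0 →₀ ℝ) → ℂ}
    (hφ : ∀ w, Tendsto
      (fun n => ∫ f, Complex.exp ((pathPairing f w : ℝ) * Complex.I) ∂(μ n : Measure C(ℝ≥0, ℝ))) l
      (𝓝 (φ w))) :
    ∃ ν : ProbabilityMeasure C(ℝ≥0, ℝ),
      (∀ w, ∫ f, Complex.exp ((pathPairing f w : ℝ) * Complex.I) ∂(ν : Measure C(ℝ≥0, ℝ)) = φ w) ∧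
      Tendsto μ l (𝓝 ν) := by
  -- With the discrete topology on the test measures, joint continuity of the pairing reduces to
  -- continuity in the path.
  let : TopologicalSpace (ℝ≥0 →₀ ℝ) := ⊥
  have : DiscreteTopology (ℝ≥0 →₀ ℝ) := ⟨rfl⟩
  have hL : Continuous fun p : C(ℝ≥0, ℝ) × (ℝ≥0 →₀ ℝ) => pathPairing p.1 p.2 := by
    rw [continuous_prod_of_discrete_right]
    intro w
    simp_rw [pathPairing_apply]
    fun_prop
  let e : (ℝ≥0 →₀ ℝ) → BoundedContinuousFunction C(ℝ≥0, ℝ) ℂ :=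
    BoundedContinuousFunction.char Real.continuous_probChar hL
  have he : ∀ w f, e w f = Complex.exp ((pathPairing f w : ℝ) * Complex.I) := fun w f => rfl
  have hcompact : IsCompact (closure {μ n | n}) :=
    isCompact_closure_of_isTightMeasureSet (by simpa using hμ)
  -- Prokhorov gives compactness, so an ultrafilter finer than `l` yields a limit point. Convergence
  -- along `l` itself follows because the character polynomials separate paths.
  let U : Ultrafilter τ := Ultrafilter.of l
  obtain ⟨ν, -, hν : Tendsto μ U (𝓝 ν)⟩ := hcompact.ultrafilter_le_nhds (U.map μ)
    (.trans (by simp) (monotone_principal subset_closure))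
  have hνφ : ∀ w, ∫ f, Complex.exp ((pathPairing f w : ℝ) * Complex.I)
      ∂(ν : Measure C(ℝ≥0, ℝ)) = φ w := fun w => by
    rw [ProbabilityMeasure.tendsto_iff_forall_integral_rclike_tendsto ℂ] at hν
    exact tendsto_nhds_unique (hν (e w)) ((hφ w).mono_left (Ultrafilter.of_le l))
  refine ⟨ν, hνφ, ?_⟩
  refine ProbabilityMeasure.tendsto_of_tight_of_separatesPoints hμ (𝕜 := ℂ)
    (A := BoundedContinuousFunction.charPoly Real.continuous_probChar hL) ?_ ?_
  · refine BoundedContinuousFunction.separatesPoints_charPoly Real.continuous_probChar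
      Real.probChar_ne_one _ fun f hf hf0 => hf ?_
    ext t
    have h1 := DFunLike.congr_fun hf0 (Finsupp.single t 1)
    change Finsupp.linearCombination ℝ f (Finsupp.single t 1) = 0 at h1
    simpa using h1
  · intro g hg
    rw [BoundedContinuousFunction.mem_charPoly] at hg
    obtain ⟨w, hw⟩ := hg
    have hint : ∀ μ : ProbabilityMeasure C(ℝ≥0, ℝ), ∫ f, g f ∂(μ : Measure C(ℝ≥0, ℝ)) =
        w.coeff.sum fun a z => z * ∫ f, Complex.exp ((pathPairing f a : ℝ) * Complex.I)
          ∂(μ : Measure C(ℝ≥0, ℝ)) := fun μ => by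
      simp_rw [hw, Finsupp.sum]
      rw [integral_finsetSum]
      · refine Finset.sum_congr rfl fun a _ => ?_
        rw [integral_const_mul]
        rfl
      · exact fun a _ => ((e a).integrable (μ : Measure C(ℝ≥0, ℝ))).const_mul _
    simp_rw [hint, hνφ]
    exact tendsto_finsetSum _ fun a _ => (hφ a).const_mul _

end WeakConvergence

/-! ### Rescaled increments of the limit process -/

section Increments

variable {Ω : Type*} [MeasurableSpace Ω] {P : Measure Ω} {a b : ℝ} {R : ℝ → ℝ → ℝ} {h : ℝ → ℝ}
  {S : ℝ≥0 → Ω → ℝ}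

lemma IsLimitProcess.integral_increment_mul (hS : IsLimitProcess R h S P) (t t' s s' : ℝ≥0) :
    ∫ ω, (S t' ω - S t ω) * (S s' ω - S s ω) ∂P = covIncrement R h t t' s s' := by
  have hi : ∀ x y, Integrable (fun ω => S x ω * S y ω) P := fun x y =>
    (IsCenteredGaussianWithCov.memLp_two hS x).integrable_mul
      (IsCenteredGaussianWithCov.memLp_two hS y)
  have h1 : ∀ ω, (S t' ω - S t ω) * (S s' ω - S s ω) =
      S t' ω * S s' ω - S t' ω * S s ω - S t ω * S s' ω + S t ω * S s ω := fun ω => by ring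
  have i1 : Integrable (fun ω => S t' ω * S s' ω - S t' ω * S s ω) P := (hi _ _).sub (hi _ _)
  have i2 : Integrable (fun ω => S t' ω * S s' ω - S t' ω * S s ω - S t ω * S s' ω) P :=
    i1.sub (hi _ _)
  simp_rw [h1]
  rw [integral_add i2 (hi _ _), integral_sub i1 (hi _ _), integral_sub (hi _ _) (hi _ _)]
  simp_rw [hS.cov]
  rfl

/-- The rescaled increments of the limit process form a centered Gaussian field. -/
lemma IsLimitProcess.rescaledIncrement (hS : IsLimitProcess R h S P) (ε : ℝ≥0) :
    IsCenteredGaussianWithCov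
      (fun (p : ℝ≥0 × ℝ≥0) ω => rescaledIncrement (fun x => S x ω) (h p.1) p.1 ε p.2)
      (rescaledCov R h ε) P := by
  classical
  refine ⟨hS.gaussian.of_isGaussianProcess fun p => ⟨{p.1, p.1 + ε * p.2},
    { toFun := fun x => (x ⟨p.1 + ε * p.2, by simp⟩ - x ⟨p.1, by simp⟩) / (ε : ℝ) ^ h p.1
      map_add' := fun x y => by simp only [Pi.add_apply]; ring
      map_smul' := fun c x => by simp only [Pi.smul_apply, smul_eq_mul, RingHom.id_apply]; ring },
    fun ω => rfl⟩, fun p => ?_, fun p q => ?_⟩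
  · simp only [Multifractional.rescaledIncrement]
    have hi : ∀ x, Integrable (S x) P := fun x => (hS.gaussian.hasGaussianLaw_eval x).integrable
    rw [integral_div, integral_sub (hi _) (hi _), hS.centered, hS.centered]
    simp
  · simp only [Multifractional.rescaledIncrement, div_mul_div_comm]
    rw [integral_div, hS.integral_increment_mul]
    rfl

lemma IsLimitProcess.integral_rescaledIncrement_sub_sq (hS : IsLimitProcess R h S P)
    (t ε u v : ℝ≥0) :
    ∫ ω, (Multifractional.rescaledIncrement (fun x => S x ω) (h t) t ε v -
      Multifractional.rescaledIncrement (fun x => S x ω) (h t) t ε u) ^ 2 ∂P =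
      covIncrement R h (t + ε * u) (t + ε * v) (t + ε * u) (t + ε * v) /
        ((ε : ℝ) ^ h t * (ε : ℝ) ^ h t) := by
  rw [← hS.integral_increment_mul, ← integral_div]
  refine integral_congr_ae (Eventually.of_forall fun ω => ?_)
  simp only [Multifractional.rescaledIncrement]
  ring

/-- The constant `C N` bounds the normalized second moments of the increments over `[0, N]`. -/
lemma IsRegular.exists_dyadicMomentBound (H : IsRegular a b R h) :
    ∃ C : ℕ → ℝ, (∀ N, 0 ≤ C N) ∧ ∀ {Ω : Type*} [MeasurableSpace Ω] {P : Measure Ω}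
      {S : ℝ≥0 → Ω → ℝ}, IsLimitProcess R h S P → ∀ t ε : ℝ≥0, 0 < ε → ε ≤ 1 →
      DyadicMomentBound C ((1 / 2 : ℝ) ^ (2 * a))
        (fun u ω => rescaledIncrement (fun x => S x ω) (h t) t ε u) P := by
  choose C hC0 hC using H.exists_covIncrement_le
  refine ⟨fun N => C N, fun N => hC0 N, fun {Ω} _ {P S} hS t ε hε hε1 N m k hk => ⟨?_, ?_⟩⟩
  · exact ((hS.rescaledIncrement ε).memLp_two (t, _)).sub
      ((hS.rescaledIncrement ε).memLp_two (t, _))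
  · rw [hS.integral_rescaledIncrement_sub_sq]
    have e1 : (((k + 1 : ℕ) / 2 ^ m : ℝ≥0) : ℝ) - ((k : ℕ) / 2 ^ m : ℝ≥0) = (1 / 2) ^ m := by
      push_cast
      rw [one_div, inv_pow]
      field_simp
      ring
    refine (hC N t ε _ _ hε hε1 ?_ ?_ ?_).trans ?_
    · gcongr; simp
    · rw [NNReal.coe_div, div_le_iff₀ (by simp)]
      push_cast
      exact_mod_cast hk
    · rw [e1]
      exact pow_le_one₀ (by norm_num) (by norm_num)
    · rw [e1, ← Real.rpow_natCast, ← Real.rpow_mul (by norm_num), ← Real.rpow_natCast,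
        ← Real.rpow_mul (by norm_num), mul_comm (m : ℝ)]

/-- This is where `a > 1/2` makes second moments sufficient for chaining: `2 ^ m` intervals of
variance `2 ^ (-2am)` have summable total. -/
lemma IsRegular.two_mul_rpow_lt_one (H : IsRegular a b R h) : 2 * (1 / 2 : ℝ) ^ (2 * a) < 1 := by
  have := Real.rpow_lt_rpow_of_exponent_gt (x := 1 / 2) (by norm_num) (by norm_num)
    (show 1 < 2 * a by linarith [H.half_lt])
  rw [Real.rpow_one] at this
  linarith

/-- The limit process has a continuous modification. -/
lemma IsLimitProcess.exists_isContinuousModification [IsProbabilityMeasure P]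
    (hS : IsLimitProcess R h S P) (H : IsRegular a b R h) :
    ∃ Y : Ω → C(ℝ≥0, ℝ), IsContinuousModification Y S P := by
  obtain ⟨C, hC0, hC⟩ := H.exists_dyadicMomentBound
  -- At time `0` and scale `1` the rescaled increments are `S u - S 0`, so the uniform bounds apply
  -- to `S` itself.
  have e : ∀ u ω, Multifractional.rescaledIncrement (fun x => S x ω) (h (0 : ℝ≥0)) 0 1 u =
      S u ω - S 0 ω := fun u ω => by simp [Multifractional.rescaledIncrement]
  have hb : DyadicMomentBound C ((1 / 2 : ℝ) ^ (2 * a)) S P := by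
    have := hC hS 0 1 one_pos le_rfl
    unfold DyadicMomentBound at this
    simp_rw [e, sub_sub_sub_cancel_right] at this
    exact this
  refine hb.exists_isContinuousModification hC0 (by positivity) H.two_mul_rpow_lt_one
    (fun t => IsCenteredGaussianWithCov.memLp_two hS t) fun t => ?_
  obtain ⟨c, hc0, hc⟩ := H.exists_covIncrement_le t
  have hbound : ∀ m, ∫ ω, (S (dyadicFloor m t) ω - S t ω) ^ 2 ∂P ≤
      c * (((t : ℝ) - dyadicFloor m t) ^ (2 * a)) := fun m => by
    have h1 := hS.integral_rescaledIncrement_sub_sq 0 1 (dyadicFloor m t) t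
    simp_rw [e, sub_sub_sub_cancel_right] at h1
    have h2 := hc 0 1 (dyadicFloor m t) t one_pos le_rfl (dyadicFloor_le m t) le_rfl ?_
    · simp_rw [sub_sq_comm (S (dyadicFloor m t) _)]
      rw [h1]
      exact h2
    · have h3 : (t : ℝ) < dyadicFloor m t + (1 / 2) ^ m := by
        exact_mod_cast lt_dyadicFloor_add m t
      have h4 : ((1 : ℝ) / 2) ^ m ≤ 1 := pow_le_one₀ (by norm_num) (by norm_num)
      linarith
  have ha : 0 < 2 * a := by linarith [H.half_lt]
  have h0 : Tendsto (fun m => c * (((t : ℝ) - dyadicFloor m t) ^ (2 * a))) atTop (𝓝 0) := by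
    have h1 : Tendsto (fun m => (dyadicFloor m t : ℝ)) atTop (𝓝 t) :=
      (NNReal.continuous_coe.tendsto _).comp (tendsto_dyadicFloor t)
    have h2 := ((h1.const_sub (t : ℝ)).rpow_const (p := 2 * a) (Or.inr ha.le)).const_mul c
    rwa [sub_self, Real.zero_rpow ha.ne', mul_zero] at h2
  exact squeeze_zero (fun m => integral_nonneg fun ω => sq_nonneg _) hbound h0

end Increments

/-! ### The limit law at a fixed time -/

section TangentLaw

variable {Ω : Type*} [MeasurableSpace Ω] {P : Measure Ω} {a b : ℝ} {R : ℝ → ℝ → ℝ} {h : ℝ → ℝ}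
  {S : ℝ≥0 → Ω → ℝ}

lemma IsContinuousModification.ae_eq {Y Y' : Ω → C(ℝ≥0, ℝ)} (hY : IsContinuousModification Y S P)
    (hY' : IsContinuousModification Y' S P) : Y =ᵐ[P] Y' := by
  obtain ⟨D, hDc, hD⟩ := TopologicalSpace.exists_countable_dense ℝ≥0
  have h1 : ∀ᵐ ω ∂P, ∀ t ∈ D, Y ω t = Y' ω t :=
    (ae_ball_iff hDc).2 fun t _ => (hY t).trans (hY' t).symm
  filter_upwards [h1] with ω hω
  exact DFunLike.coe_injective (Continuous.ext_on hD (map_continuous _) (map_continuous _) hω)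

lemma IsContinuousModification.rescaledPath_ae_eq {Y : Ω → C(ℝ≥0, ℝ)}
    (hY : IsContinuousModification Y S P) (H : ℝ) (t ε u : ℝ≥0) :
    (fun ω => rescaledPath (Y ω) H t ε u) =ᵐ[P]
      fun ω => rescaledIncrement (fun x => S x ω) H t ε u := by
  filter_upwards [hY t, hY (t + ε * u)] with ω h1 h2
  change ((Y ω (t + ε * u)) - Y ω t) / (ε : ℝ) ^ H = _
  rw [h1, h2]
  rfl

lemma IsContinuousModification.aemeasurable_rescaledPath {Y : Ω → C(ℝ≥0, ℝ)}
    (hY : IsContinuousModification Y S P) (hS : IsLimitProcess R h S P) (t ε : ℝ≥0) :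
    AEMeasurable (fun ω => rescaledPath (Y ω) (h t) t ε) P :=
  aemeasurable_continuousMap fun u =>
    ((hS.rescaledIncrement ε).aemeasurable (t, u)).congr (hY.rescaledPath_ae_eq _ t ε u).symm

lemma DyadicMomentBound.congr {C : ℕ → ℝ} {τ : ℝ} {X X' : ℝ≥0 → Ω → ℝ}
    (hX : DyadicMomentBound C τ X P) (hXX' : ∀ t, X t =ᵐ[P] X' t) :
    DyadicMomentBound C τ X' P := fun N m k hk => by
  obtain ⟨h1, h2⟩ := hX N m k hk
  have e : (fun ω => X ((k + 1 : ℕ) / 2 ^ m) ω - X ((k : ℕ) / 2 ^ m) ω) =ᵐ[P]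
      fun ω => X' ((k + 1 : ℕ) / 2 ^ m) ω - X' ((k : ℕ) / 2 ^ m) ω := (hXX' _).sub (hXX' _)
  refine ⟨h1.ae_eq e, le_trans (le_of_eq (integral_congr_ae ?_)) h2⟩
  filter_upwards [e] with ω hω
  rw [← hω]

lemma tangentCov_comm (p q : ℝ≥0 × ℝ≥0) : tangentCov R h p q = tangentCov R h q p := by
  unfold tangentCov
  rcases eq_or_ne p.1 q.1 with hpq | hpq
  · rw [if_pos hpq, if_pos hpq.symm, hpq, add_comm ((p.2 : ℝ) ^ _), abs_sub_comm]
  · rw [if_neg hpq, if_neg hpq.symm]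

/-- The pairing is almost surely a finite combination of Gaussian increments, so its characteristic
function is an explicit function of the covariance. -/
lemma IsRegular.pathPairing_tendsto (H : IsRegular a b R h) (hS : IsLimitProcess R h S P)
    {Y : Ω → C(ℝ≥0, ℝ)} (hY : IsContinuousModification Y S P) (t : ℝ≥0) (w : ℝ≥0 →₀ ℝ) :
    Tendsto (fun ε => ∫ ω, Complex.exp
        ((pathPairing (rescaledPath (Y ω) (h t) t ε) w : ℝ) * Complex.I) ∂P) (𝓝[>] 0)
      (𝓝 (Complex.exp (-((∑ k : w.support, ∑ l : w.support,
        w k * w l * tangentCov R h (t, k) (t, l) : ℝ) : ℂ) / 2))) := by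
  have h1 : ∀ ε, ∫ ω, Complex.exp
      ((pathPairing (rescaledPath (Y ω) (h t) t ε) w : ℝ) * Complex.I) ∂P =
      Complex.exp (-((∑ k : w.support, ∑ l : w.support,
        w k * w l * rescaledCov R h ε (t, k) (t, l) : ℝ) : ℂ) / 2) := fun ε => by
    rw [← (hS.rescaledIncrement ε).integral_cexp (fun k : w.support => (t, (k : ℝ≥0)))
      fun k => w k]
    refine integral_congr_ae ?_
    have h2 : ∀ᵐ ω ∂P, ∀ k ∈ w.support, rescaledPath (Y ω) (h t) t ε k =
        rescaledIncrement (fun x => S x ω) (h t) t ε k :=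
      (ae_ball_iff w.support.countable_toSet).2 fun k _ => hY.rescaledPath_ae_eq _ t ε k
    filter_upwards [h2] with ω hω
    rw [pathPairing_apply,
      Finset.sum_coe_sort w.support fun k => w k * rescaledIncrement (fun x => S x ω) (h t) t ε k]
    congr 3
    exact Finset.sum_congr rfl fun k hk => by rw [hω k hk]
  simp_rw [h1]
  refine (Complex.continuous_exp.tendsto _).comp (Tendsto.div_const (Tendsto.neg ?_) 2)
  refine (Complex.continuous_ofReal.tendsto _).comp ?_
  exact tendsto_finsetSum _ fun k _ => tendsto_finsetSum _ fun l _ =>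
    (H.tendsto_rescaledCov _ _).const_mul _

/-- The rescaled paths at `t` converge in law to a centered Gaussian process with continuous
paths. -/
lemma IsRegular.exists_tangentLaw [IsProbabilityMeasure P] (H : IsRegular a b R h)
    (hS : IsLimitProcess R h S P) (t : ℝ≥0) :
    ∃ ν : ProbabilityMeasure C(ℝ≥0, ℝ),
      IsCenteredGaussianWithCov (fun u (f : C(ℝ≥0, ℝ)) => f u)
        (fun u v => tangentCov R h (t, u) (t, v)) ν ∧
      ∀ Y : Ω → C(ℝ≥0, ℝ), IsContinuousModification Y S P →
        TendstoInDistribution (fun (ε : ℝ≥0) ω => rescaledPath (Y ω) (h t) t ε) (𝓝[>] 0)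
          (id : C(ℝ≥0, ℝ) → C(ℝ≥0, ℝ)) (fun _ => P) ν := by
  obtain ⟨Y, hY⟩ := hS.exists_isContinuousModification H
  have hm := hY.aemeasurable_rescaledPath hS t
  -- The moment bounds hold for scales in `(0, 1]`; other scales are replaced by `1`, which changes
  -- nothing near `0⁺`.
  let c : ℝ≥0 → ℝ≥0 := fun ε => if 0 < ε ∧ ε ≤ 1 then ε else 1
  have hc : ∀ ε, 0 < c ε ∧ c ε ≤ 1 := fun ε => by
    by_cases hε : 0 < ε ∧ ε ≤ 1
    · simp only [c, if_pos hε]; exact hε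
    · simp only [c, if_neg hε]; exact ⟨one_pos, le_rfl⟩
  have hc1 : ∀ᶠ ε in 𝓝[>] (0 : ℝ≥0), c ε = ε := by
    filter_upwards [Ioc_mem_nhdsGT (zero_lt_one' ℝ≥0)] with ε hε
    exact if_pos ⟨hε.1, hε.2⟩
  obtain ⟨C, hC0, hC⟩ := H.exists_dyadicMomentBound
  have htight : IsTightMeasureSet
      {P.map (fun ω => rescaledPath (Y ω) (h t) t (c ε)) | ε : ℝ≥0} := by
    refine isTightMeasureSet_of_dyadicMomentBound (fun ε => hm (c ε)) (fun ε ω => ?_)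
      (fun ε => (hC hS t (c ε) (hc ε).1 (hc ε).2).congr
        fun u => (hY.rescaledPath_ae_eq _ t (c ε) u).symm) hC0 (by positivity)
      H.two_mul_rpow_lt_one
    change ((Y ω (t + c ε * 0)) - Y ω t) / ((c ε : ℝ≥0) : ℝ) ^ h t = 0
    simp
  let μ : ℝ≥0 → ProbabilityMeasure C(ℝ≥0, ℝ) := fun ε =>
    ⟨P.map (fun ω => rescaledPath (Y ω) (h t) t ε), Measure.isProbabilityMeasure_map (hm ε)⟩
  have hcont : ∀ w : ℝ≥0 →₀ ℝ, Continuous fun f : C(ℝ≥0, ℝ) =>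
      Complex.exp ((pathPairing f w : ℝ) * Complex.I) := fun w => by
    simp_rw [pathPairing_apply]
    fun_prop
  obtain ⟨ν, hν, hμν⟩ := exists_tendsto_of_tight (l := 𝓝[>] (0 : ℝ≥0)) (μ := fun ε => μ (c ε))
    htight (φ := fun w => Complex.exp (-((∑ k : w.support, ∑ l : w.support,
        w k * w l * tangentCov R h (t, k) (t, l) : ℝ) : ℂ) / 2)) fun w => by
      refine (H.pathPairing_tendsto hS hY t w).congr' ?_
      filter_upwards [hc1] with ε hε
      rw [hε, ProbabilityMeasure.coe_mk, integral_map (hm ε) (hcont w).aestronglyMeasurable]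
  refine ⟨ν, ?_, fun Y' hY' => ?_⟩
  · refine IsCenteredGaussianWithCov.of_integral_cexp (fun u =>
      (continuous_eval_const u).measurable.aemeasurable)
      (fun u v => tangentCov_comm _ _) fun s w => ?_
    classical
    let w' : ℝ≥0 → ℝ := fun x => if hx : x ∈ s then w ⟨x, hx⟩ else 0
    have hw' : ∀ k : s, w' k = w k := fun k => dif_pos k.2
    -- The support of `W` may be smaller than `s`, since zero weights drop out; `hsum` shows that
    -- sums agree.
    let W : ℝ≥0 →₀ ℝ := Finsupp.onFinset s w' fun x hx => by
      by_contra hxs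
      exact hx (dif_neg hxs)
    have hsum : ∀ g : ℝ≥0 → ℝ, ∑ k ∈ W.support, W k * g k = ∑ k : s, w k * g k := fun g => by
      have h1 : ∑ k ∈ W.support, W k * g k = ∑ k ∈ s, W k * g k :=
        Finset.sum_subset Finsupp.support_onFinset_subset fun x _ hx => by
          rw [Finsupp.notMem_support_iff.1 hx, zero_mul]
      rw [h1, ← Finset.sum_coe_sort]
      exact Finset.sum_congr rfl fun k _ => by rw [← hw' k]; rfl
    have h1 := hν W
    simp_rw [pathPairing_apply, hsum] at h1
    rw [h1]
    congr 4
    simp_rw [mul_assoc, ← Finset.mul_sum]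
    rw [Finset.sum_coe_sort W.support fun k => W k * ∑ l : W.support,
      W l * tangentCov R h (t, k) (t, l), hsum]
    refine Finset.sum_congr rfl fun k _ => ?_
    rw [Finset.sum_coe_sort W.support fun l => W l * tangentCov R h (t, k) (t, l), hsum]
  · refine ⟨hY'.aemeasurable_rescaledPath hS t, aemeasurable_id, ?_⟩
    have e1 : (⟨(ν : Measure C(ℝ≥0, ℝ)).map id, Measure.isProbabilityMeasure_map aemeasurable_id⟩ :
        ProbabilityMeasure C(ℝ≥0, ℝ)) = ν := Subtype.ext Measure.map_id
    rw [e1]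
    refine hμν.congr' ?_
    filter_upwards [hc1] with ε hε
    refine Subtype.ext ?_
    rw [hε]
    refine Measure.map_congr ?_
    filter_upwards [hY.ae_eq hY'] with ω hω
    rw [hω]

end TangentLaw

/-! ### Independent assembly of the tangent field -/

section TangentField

variable {R : ℝ → ℝ → ℝ} {h : ℝ → ℝ}

lemma measurable_path_eval (u : ℝ≥0) : Measurable fun f : C(ℝ≥0, ℝ) => f u :=
  (continuous_eval_const u).measurable

/-- The values of independent Gaussian path-valued variables form a Gaussian field. -/
lemma isGaussianProcess_of_iIndepFun {Ω τ : Type*} [MeasurableSpace Ω] {P : Measure Ω}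
    {T : τ → Ω → C(ℝ≥0, ℝ)} (hT : iIndepFun T P)
    (hG : ∀ t, IsGaussianProcess (fun u ω => T t ω u) P) :
    IsGaussianProcess (fun (p : τ × ℝ≥0) ω => T p.1 ω p.2) P := by
  classical
  refine ⟨fun I => ?_⟩
  -- The finite index set is enlarged to a rectangle `A × B`, where independence of the Gaussian
  -- blocks gives joint Gaussianity, and then `L` projects back.
  let A : Finset τ := I.image Prod.fst
  let B : Finset ℝ≥0 := I.image Prod.snd
  have h1 : iIndepFun (fun (t : A) ω => B.restrict (fun u => T t ω u)) P :=
    (hT.precomp (g := ((↑) : A → τ)) Subtype.val_injective).comp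
      (fun _ f => B.restrict fun u => f u)
      fun _ => measurable_pi_lambda _ fun u : B => measurable_path_eval u
  have h2 := h1.hasGaussianLaw fun t : A => (hG t).hasGaussianLaw B
  let L : (A → B → ℝ) →L[ℝ] (I → ℝ) :=
    { toFun := fun x p => x ⟨p.1.1, Finset.mem_image_of_mem _ p.2⟩
        ⟨p.1.2, Finset.mem_image_of_mem _ p.2⟩
      map_add' := fun x y => rfl
      map_smul' := fun c x => rfl }
  exact h2.map L

/-- There is a field with independent continuous sections of prescribed Gaussian laws. -/
lemma exists_tangentField {ν : ℝ≥0 → ProbabilityMeasure C(ℝ≥0, ℝ)}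
    (hν : ∀ t, IsCenteredGaussianWithCov (fun u (f : C(ℝ≥0, ℝ)) => f u)
      (fun u v => tangentCov R h (t, u) (t, v)) (ν t)) :
    ∃ (Ω' : Type) (_ : MeasurableSpace Ω') (P' : Measure Ω') (_ : IsProbabilityMeasure P')
      (T : ℝ≥0 → Ω' → C(ℝ≥0, ℝ)),
      IsCenteredGaussianWithCov (fun (p : ℝ≥0 × ℝ≥0) ω => T p.1 ω p.2) (tangentCov R h) P' ∧
      iIndepFun T P' ∧ ∀ t, AEMeasurable (T t) P' ∧ P'.map (T t) = ν t := by
  let P' := Measure.infinitePi fun t => (ν t : Measure C(ℝ≥0, ℝ))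
  let T : ℝ≥0 → (ℝ≥0 → C(ℝ≥0, ℝ)) → C(ℝ≥0, ℝ) := fun t ω => ω t
  have hmp : ∀ t, MeasurePreserving (T t) P' (ν t) := fun t => measurePreserving_eval_infinitePi _ t
  have hint : ∀ t (g : C(ℝ≥0, ℝ) → ℝ), Measurable g →
      ∫ ω, g (T t ω) ∂P' = ∫ f, g f ∂(ν t : Measure C(ℝ≥0, ℝ)) := fun t g hg => by
    rw [← (hmp t).map_eq, integral_map (hmp t).aemeasurable hg.aestronglyMeasurable]
  have hindep : iIndepFun T P' :=
    iIndepFun_infinitePi (X := fun _ (f : C(ℝ≥0, ℝ)) => f) fun _ => measurable_id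
  refine ⟨_, inferInstance, P', inferInstance, T, ⟨?_, fun p => ?_, fun p q => ?_⟩, hindep,
    fun t => ⟨(hmp t).aemeasurable, (hmp t).map_eq⟩⟩
  · refine isGaussianProcess_of_iIndepFun hindep fun t => ⟨fun I => ⟨?_⟩⟩
    have h1 := ((hν t).gaussian.hasGaussianLaw I).isGaussian_map
    have hI : Measurable fun f : C(ℝ≥0, ℝ) => I.restrict fun u => f u :=
      measurable_pi_lambda _ fun u : I => measurable_path_eval u
    rw [← (hmp t).map_eq, Measure.map_map hI (hmp t).measurable] at h1
    exact h1
  · rw [hint p.1 (fun f => f p.2) (measurable_path_eval _)]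
    exact (hν p.1).centered p.2
  · obtain ⟨t, u⟩ := p
    obtain ⟨s, v⟩ := q
    rcases eq_or_ne t s with rfl | hts
    · rw [← (hν t).cov u v]
      exact hint t (fun f => f u * f v) ((measurable_path_eval u).mul (measurable_path_eval v))
    · have h1 : IndepFun (fun ω => T t ω u) (fun ω => T s ω v) P' :=
        (hindep.indepFun hts).comp (measurable_path_eval u) (measurable_path_eval v)
      rw [h1.integral_fun_mul_eq_mul_integral
        ((measurable_path_eval u).comp (hmp t).measurable).aestronglyMeasurable
        ((measurable_path_eval v).comp (hmp s).measurable).aestronglyMeasurable,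
        hint t (fun f => f u) (measurable_path_eval _), (hν t).centered u, zero_mul]
      exact (if_neg hts).symm

lemma IsCenteredGaussianWithCov.isFractionalBrownianMotion {Ω : Type*} [MeasurableSpace Ω]
    {P : Measure Ω} {T : ℝ≥0 → Ω → C(ℝ≥0, ℝ)}
    (hT : IsCenteredGaussianWithCov (fun (p : ℝ≥0 × ℝ≥0) ω => T p.1 ω p.2) (tangentCov R h) P)
    {t : ℝ≥0} (ht : 1 / 2 < h t) (ht1 : h t < 1) :
    IsFractionalBrownianMotion (h t) (fun u ω => T t ω u) P ∧
      ∫ ω, T t ω 1 ^ 2 ∂P = R (h t) (h t) / (2 * h t ^ 2 - h t) := by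
  have h0 : 2 * h t ^ 2 - h t ≠ 0 := by nlinarith
  have h2 : 4 * h t ^ 2 - 2 * h t = 2 * (2 * h t ^ 2 - h t) := by ring
  have hvar : ∫ ω, T t ω 1 ^ 2 ∂P = R (h t) (h t) / (2 * h t ^ 2 - h t) := by
    simp_rw [sq (T t _ _)]
    rw [hT.cov (t, 1) (t, 1), tangentCov, if_pos rfl]
    simp only [NNReal.coe_one, Real.one_rpow, sub_self, abs_zero]
    rw [Real.zero_rpow (by linarith), h2, div_mul_eq_mul_div, div_eq_div_iff (by positivity) h0]
    ring
  refine ⟨⟨⟨by linarith, ht1⟩, hT.gaussian.comp_right fun u => (t, u), fun u => hT.centered (t, u),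
    fun u v => ?_⟩, hvar⟩
  rw [hvar, hT.cov (t, u) (t, v), tangentCov, if_pos rfl]
  congr 1
  rw [h2, div_div, mul_comm 2]

end TangentField

/-! ### Extension of the data to the whole line -/

section Extension

/-- Continuous `R` on `[a, b]²` and Hölder `h` on `[0, ∞)` extend to regular functions. -/
lemma exists_isRegular {a b : ℝ} (ha : 1 / 2 < a) (hab : a ≤ b) (hb : b < 1) {R : ℝ → ℝ → ℝ}
    (hR : ContinuousOn (Function.uncurry R) (Icc a b ×ˢ Icc a b)) {h : ℝ → ℝ}
    (hmem : ∀ t ∈ Ici (0 : ℝ), h t ∈ Icc a b)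
    (hHolder : ∃ C r : ℝ≥0, 0 < r ∧ HolderOnWith C r h (Ici 0)) :
    ∃ R' h', IsRegular a b R' h' ∧ (∀ t : ℝ, 0 ≤ t → h' t = h t) ∧
      ∀ x ∈ Icc a b, ∀ y ∈ Icc a b, R' x y = R x y := by
  have hproj : ∀ x : ℝ, max a (min b x) ∈ Icc a b := fun x =>
    ⟨le_max_left _ _, max_le hab (min_le_left _ _)⟩
  have hproj_eq : ∀ x ∈ Icc a b, max a (min b x) = x := fun x hx => by
    rw [min_eq_right hx.2, max_eq_right hx.1]
  -- Compose with the retractions onto `[a, b]` and `[0, ∞)`; the latter is 1-Lipschitz and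
  -- preserves the Hölder bound.
  refine ⟨fun x y => R (max a (min b x)) (max a (min b y)), fun x => h (max x 0),
    ⟨ha, hb, ?_, ?_, fun x => hmem _ (le_max_right x 0), ?_⟩,
    fun t ht => congrArg h (max_eq_left ht),
    fun x hx y hy => congrArg₂ R (hproj_eq x hx) (hproj_eq y hy)⟩
  · exact hR.comp_continuous (f := fun p : ℝ × ℝ => (max a (min b p.1), max a (min b p.2)))
      (by fun_prop) fun p => ⟨hproj _, hproj _⟩
  · obtain ⟨C, hC⟩ := (isCompact_Icc.prod isCompact_Icc).exists_bound_of_continuousOn hR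
    refine ⟨max C 0, le_max_right _ _, fun x y => le_max_of_le_left ?_⟩
    exact hC (max a (min b x), max a (min b y)) ⟨hproj _, hproj _⟩
  · obtain ⟨C, r, hr, hC⟩ := hHolder
    refine ⟨C, r, C.2, hr, fun x y => ?_⟩
    have h1 := hC.dist_le (x := max x 0) (y := max y 0) (le_max_right x 0) (le_max_right y 0)
    rw [Real.dist_eq, Real.dist_eq] at h1
    refine h1.trans ?_
    exact mul_le_mul_of_nonneg_left
      (Real.rpow_le_rpow (abs_nonneg _) (abs_max_sub_max_le_abs x y 0) r.2) C.2

variable {a b : ℝ} {R R' : ℝ → ℝ → ℝ} {h h' : ℝ → ℝ}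

lemma limitCov_congr (hmem : ∀ t ∈ Ici (0 : ℝ), h t ∈ Icc a b) (hh : ∀ t : ℝ, 0 ≤ t → h' t = h t)
    (hR : ∀ x ∈ Icc a b, ∀ y ∈ Icc a b, R' x y = R x y) : limitCov R' h' = limitCov R h := by
  ext t s
  refine intervalIntegral.integral_congr fun θ hθ => intervalIntegral.integral_congr fun σ hσ => ?_
  rw [uIcc_of_le t.coe_nonneg] at hθ
  rw [uIcc_of_le s.coe_nonneg] at hσ
  have e1 := hR _ (hmem θ hθ.1) _ (hmem σ hσ.1)
  have e2 := hR _ (hmem σ hσ.1) _ (hmem θ hθ.1)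
  simp only [kernel, orderedR, hh θ hθ.1, hh σ hσ.1, e1, e2]

lemma tangentCov_congr (hmem : ∀ t ∈ Ici (0 : ℝ), h t ∈ Icc a b)
    (hh : ∀ t : ℝ, 0 ≤ t → h' t = h t)
    (hR : ∀ x ∈ Icc a b, ∀ y ∈ Icc a b, R' x y = R x y) : tangentCov R' h' = tangentCov R h := by
  ext p q
  have hp := hmem p.1 p.1.coe_nonneg
  simp only [tangentCov, hh _ p.1.coe_nonneg, hR _ hp _ hp]

end Extension

end Multifractional

/-! ### The main theorem -/

theorem proposition1
    {Ω : Type*} [MeasurableSpace Ω] (P : Measure Ω) [IsProbabilityMeasure P]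
    (a b : ℝ) (ha : 1 / 2 < a) (hab : a ≤ b) (hb : b < 1)
    -- the asymptotic covariance: a positive continuous function on `[a, b]²`
    (R : ℝ → ℝ → ℝ)
    (hRcont : ContinuousOn (Function.uncurry R) (Icc a b ×ˢ Icc a b))
    (hRpos : ∀ H₁ ∈ Icc a b, ∀ H₂ ∈ Icc a b, 0 < R H₁ H₂)
    -- the multifractional function: Hölder continuous on `[0, ∞)` with values in `[a, b]`
    (h : ℝ → ℝ) (hmem : ∀ t ∈ Ici (0 : ℝ), h t ∈ Icc a b)
    (hHolder : ∃ C r : ℝ≥0, 0 < r ∧ HolderOnWith C r h (Ici 0))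
    -- the limit process
    (S : ℝ≥0 → Ω → ℝ) (hS : Multifractional.IsLimitProcess R h S P) :
    -- the tangent field `T`, with continuous paths `u ↦ T t ω u`
    ∃ (Ω' : Type) (_ : MeasurableSpace Ω') (P' : Measure Ω') (_ : IsProbabilityMeasure P')
      (T : ℝ≥0 → Ω' → C(ℝ≥0, ℝ)),
      -- it is the centered Gaussian field with the tangent covariance
      Multifractional.IsCenteredGaussianWithCov
        (fun (p : ℝ≥0 × ℝ≥0) ω => T p.1 ω p.2) (Multifractional.tangentCov R h) P' ∧
      -- it is independent across distinct `t`
      iIndepFun T P' ∧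
      -- convergence of the finite-dimensional distributions, jointly in `(t, u)`
      (∀ I : Finset (ℝ≥0 × ℝ≥0),
        TendstoInDistribution
          (fun (ε : ℝ≥0) ω (p : I) => Multifractional.rescaledIncrement
            (fun x => S x ω) (h p.1.1) p.1.1 ε p.1.2)
          (𝓝[>] 0) (fun ω (p : I) => T p.1.1 ω p.1.2) (fun _ => P) P') ∧
      -- the limit process has a continuous modification
      (∃ Y : Ω → C(ℝ≥0, ℝ), Multifractional.IsContinuousModification Y S P) ∧
      -- and for it, at fixed `t`, there is convergence in law in the space of continuous functions
      (∀ Y : Ω → C(ℝ≥0, ℝ), Multifractional.IsContinuousModification Y S P → ∀ t : ℝ≥0,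
        TendstoInDistribution
          (fun (ε : ℝ≥0) ω => Multifractional.rescaledPath (Y ω) (h t) t ε)
          (𝓝[>] 0) (T t) (fun _ => P) P') ∧
      -- to a fractional Brownian motion with Hurst index `h t` and the stated variance
      (∀ t : ℝ≥0,
        Multifractional.IsFractionalBrownianMotion (h t) (fun u ω => T t ω u) P' ∧
        ∫ ω, T t ω 1 ^ 2 ∂P' = R (h t) (h t) / (2 * h t ^ 2 - h t)) := by
  obtain ⟨R', h', H, hh, hR⟩ :=
    Multifractional.exists_isRegular ha hab hb hRcont hmem hHolder
  have hcov := Multifractional.tangentCov_congr hmem hh hR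
  have hht : ∀ t : ℝ≥0, h' t = h t := fun t => hh t t.coe_nonneg
  have hS' : Multifractional.IsLimitProcess R' h' S P := by
    unfold Multifractional.IsLimitProcess at hS ⊢
    rwa [Multifractional.limitCov_congr hmem hh hR]
  choose ν hν hνlim using H.exists_tangentLaw hS'
  obtain ⟨Ω', mΩ', P', hP', T, hT, hindep, hlaw⟩ := Multifractional.exists_tangentField hν
  rw [hcov] at hT
  refine ⟨Ω', mΩ', P', hP', T, hT, hindep, fun I => ?_, hS'.exists_isContinuousModification H,
    fun Y hY t => ?_, fun t => hT.isFractionalBrownianMotion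
      (ha.trans_le (hmem t t.coe_nonneg).1) ((hmem t t.coe_nonneg).2.trans_lt hb)⟩
  · simp_rw [← hht]
    refine Multifractional.IsCenteredGaussianWithCov.tendstoInDistribution
      (fun ε => hS'.rescaledIncrement ε) hT (fun p q => ?_) I
    rw [← hcov]
    exact H.tendsto_rescaledCov p q
  · have h1 := hνlim t Y hY
    rw [hht t] at h1
    refine ⟨h1.forall_aemeasurable, (hlaw t).1, ?_⟩
    have h2 := h1.tendsto
    -- Convergence in law only depends on the law of the limit, so the canonical path under `ν t`
    -- may be replaced by `T t`.
    simp_rw [Measure.map_id, ← (hlaw t).2] at h2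
    exact h2
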